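/- **Setting.** Let $n,d,C\in\mathbb N$ and let $U$ be a set of domains. A *model* consists of the following. A directed acyclic graph $\mathcal G$ on the latent variables $Z_1,\dots,Z_n$ (real-valued) and the label $Y\in\{v_1,\dots,v_C\}$. For each domain $u$, a structural equation model $Z_i=f_i(\mathrm{PA}(Z_i;\mathcal G),\epsilon_i;\theta_i^{(u)})$, $Y=f_Y(\mathrm{PA}(Y;\mathcal G),\epsilon_Y;\theta_Y^{(u)})$ with mutually independent noises and domain-dependent parameters, such that for each $c$ the joint density $z\mapsto P^{(u)}(Z=z,Y=v_c)$ is positive everywhere and three times differentiable on $\mathbb R^n$. A smooth mixing function $g:\mathbb R^n\to\mathbb R^d$ which is a diffeomorphism onto its image, with $X=g(Z)$. The model is *faithful* if in every domain each conditional independence between two variables given a set of other variables is a d-separation in $\mathcal G$. The *Markov network* $\mathcal M$ is the undirected graph on $Z_1,\dots,Z_n,Y$ in which two variables are non-adjacent iff they are conditionally independent given all the others (in every domain). Let $Z_{\mathrm{pa}},Z_{\mathrm{ch}}$ be the parents and children of $Y$ in $\mathcal G$, let $Z_{\mathrm{sps}}$ (spouses) be the latent variables that share a child with $Y$ but are neither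 parents nor children of $Y$, and let $Z_{\mathrm{mb}}=Z_{\mathrm{pa}}\cup Z_{\mathrm{ch}}\cup Z_{\mathrm{sps}}$ be the Markov blanket. $Z_i$ is an *intimate neighbor* of $Z_j$ if it is adjacent in $\mathcal M$ to $Z_j$ and to all other neighbors of $Z_j$ (including $Y$, if $Y$ is a neighbor of $Z_j$). **Theorem.** Consider a faithful model (the true model) such that: 1. (Sufficient changes for $Z$.) Let $E$ be the set of edges $\{Z_i,Z_j\}$ of $\mathcal M$ between latent variables. For each $z\in\mathbb R^n$ there are a label value $c$ and domains $u_0,\dots,u_{2n+|E|}$ such that the $2n+|E|$ vectors $w(z,u_k)-w(z,u_0)$, $k\ge1$, are linearly independent, where $w(z,u)$ consists of all $\partial_i\log P^{(u)}(z,v_c)$, all $\partial_i^2\log P^{(u)}(z,v_c)$ ($i\in[n]$), and all $\partial_i\partial_j\log P^{(u)}(z,v_c)$ with $i<j$, $\{Z_i,Z_j\}\in E$. 2. (Sufficient changes for $Y$.) For each $z\in\mathbb R^n$ there are a label value $c_1$ and $|Z_{\mathrm{mb}}|$ pairs $(u_k,c_k)$ with $c_k\ne c_1$ such that the vectors $\tau(z,u_k,c_k)-\tau(z,u_k,c_1)$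 are linearly independent, where $\tau(z,u,c)=\big(\partial_i\log P^{(u)}(z,v_c)\big)_{Z_i\in Z_{\mathrm{mb}}}$. 3. (Group-specific intimate neighbors.) Every latent intimate neighbor of a parent (respectively child, spouse) of $Y$ is itself a parent (respectively child, spouse) of $Y$. Consider any faithful model with the same $n,d,C,U$, with latent variables $\hat Z$, graph $\hat{\mathcal G}$, mixing function $\hat g$ and Markov network $\hat{\mathcal M}$, such that $\hat g$ has the same image as $g$ and $(\hat g(\hat Z),\hat Y)$ has the same law as $(X,Y)$ in every domain, and such that $\hat{\mathcal M}$ has the fewest edges among all faithful models with these properties. Then the Markov blanket $\hat Z_{\mathrm{mb}}$ of the label in $\hat{\mathcal G}$ is the disjoint union of three (possibly empty) blocks $\hat Z_{S_1},\hat Z_{S_2},\hat Z_{S_3}$ that are invertible transformations of $Z_{\mathrm{pa}},Z_{\mathrm{ch}},Z_{\mathrm{sps}}$ respectively: there are diffeomorphisms $h_1,h_2,h_3$ such that $\hat z_{S_1}=h_1(z_{\mathrm{pa}})$, $\hat z_{S_2}=h_2(z_{\mathrm{ch}})$, $\hat z_{S_3}=h_3(z_{\mathrm{sps}})$ whenever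 $\hat g(\hat z)=g(z)$. -/

import Mathlib

open MeasureTheory ProbabilityTheory
open scoped ContDiff

noncomputable section

namespace LatentDA

universe w

/-! ### Variables of the model -/

/-- The variables of the structural equation model: `some i` is the latent variable `Z_i`
(for `i : Fin n`) and `none` is the label `Y`. -/
abbrev Node (n : ℕ) : Type := Option (Fin n)

/-- Range of a variable: the latent variables are real, the label takes `C` values. -/
def Val (C : ℕ) {n : ℕ} : Node n → Type
  | some _ => ℝ
  | none => Fin C

instance instMeasurableSpaceVal (C : ℕ) {n : ℕ} : (v : Node n) → MeasurableSpace (Val C v)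
  | some _ => inferInstanceAs (MeasurableSpace ℝ)
  | none => inferInstanceAs (MeasurableSpace (Fin C))

instance instStandardBorelSpaceVal (C : ℕ) {n : ℕ} :
    (v : Node n) → StandardBorelSpace (Val C v)
  | some _ => inferInstanceAs (StandardBorelSpace ℝ)
  | none => inferInstanceAs (StandardBorelSpace (Fin C))

/-- A joint value of all the variables `(Z, Y)`. -/
abbrev Assignment (n C : ℕ) : Type := ∀ v : Node n, Val C v

/-- The latent part `Z` of a joint value. -/
def latent {n C : ℕ} (x : Assignment n C) : Fin n → ℝ := fun i => x (some i)

/-- The label part `Y` of a joint value. -/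
def label {n C : ℕ} (x : Assignment n C) : Fin C := x none

/-! ### Directed graphs -/

section Graph

variable {V : Type*}

/-- The undirected graph underlying a directed graph. -/
def skeleton (E : V → V → Prop) : SimpleGraph V := SimpleGraph.fromRel E

/-- A path is active given `S` if each of its colliders has a descendant in `S` (a vertex counts
as a descendant of itself), and none of its other inner vertices belongs to `S`. -/
def IsActivePath (E : V → V → Prop) (S : Set V) {a b : V} (p : (skeleton E).Walk a b) : Prop :=
  p.IsPath ∧ ∀ x m y : V, [x, m, y] <:+: p.support →
    ((E x m ∧ E y m) → ∃ s ∈ S, Relation.ReflTransGen E m s) ∧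
    (¬ (E x m ∧ E y m) → m ∉ S)

/-- `a` and `b` are d-separated by `S`: no path between them is active given `S`. -/
def DSep (E : V → V → Prop) (a b : V) (S : Set V) : Prop :=
  ∀ p : (skeleton E).Walk a b, ¬ IsActivePath E S p

end Graph

/-! ### Derivatives -/

/-- `f` is three times differentiable on `ℝⁿ`. -/
def ThriceDifferentiable {n : ℕ} (f : (Fin n → ℝ) → ℝ) : Prop :=
  ContDiff ℝ 2 f ∧ Differentiable ℝ (iteratedFDeriv ℝ 2 f)

/-- The partial derivative of `f` with respect to the `i`-th coordinate. -/
def partialDeriv {n : ℕ} (i : Fin n) (f : (Fin n → ℝ) → ℝ) (z : Fin n → ℝ) : ℝ :=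
  fderiv ℝ f z (Pi.single i 1)

/-! ### The generative model -/

/-- A latent generative model with distribution shift, with domains `u : U`, `n` latent variables,
`d` observed features and `C` label values. The features are `X = mix Z`; in every domain `(Z, Y)`
solves a structural equation model over one and the same directed acyclic graph, with mutually
independent noises and with a domain-dependent parameter `param v u` in each equation. -/
structure LatentModel (U : Type w) (n d C : ℕ) where
  /-- `edge v v'` says that `v` is a parent of `v'` in the graph. -/
  edge : Node n → Node n → Prop
  acyclic : ∀ v, ¬ Relation.TransGen edge v v
  /-- Space of the parameters of the structural equation of `v`. -/
  Param : Node n → Type w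
  /-- The parameter of the structural equation of `v` in the domain `u`. -/
  param : ∀ v, U → Param v
  /-- The law of the noise of `v`; the noises are mutually independent, that is, their joint law
  is the product measure `Measure.pi noise`. -/
  noise : Node n → Measure ℝ
  noise_prob : ∀ v, IsProbabilityMeasure (noise v)
  /-- The mechanism of `v`: a function of the parents of `v`, of the noise and of the parameter. -/
  mech : ∀ v, (∀ p : {p // edge p v}, Val C p.1) → ℝ → Param v → Val C v
  mech_measurable : ∀ v u,
    Measurable fun q : (∀ p : {p // edge p v}, Val C p.1) × ℝ => mech v q.1 q.2 (param v u)
  /-- The value of all the variables as a function of the noises, in the domain `u`. -/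
  sol : U → (Node n → ℝ) → Assignment n C
  structural_eq : ∀ u ε v, sol u ε v = mech v (fun p => sol u ε p.1) (ε v) (param v u)
  /-- `dens u z c` is the joint density of `(Z, Y)` at `(z, c)` in the domain `u`, with respect to
  the product of the Lebesgue measure and the counting measure. -/
  dens : U → (Fin n → ℝ) → Fin C → ℝ
  dens_pos : ∀ u z c, 0 < dens u z c
  dens_diff : ∀ u c, ThriceDifferentiable fun z => dens u z c
  dens_spec : ∀ u,
    (Measure.pi noise).map (fun ε => (latent (sol u ε), label (sol u ε))) =
      ((volume : Measure (Fin n → ℝ)).prod (Measure.count : Measure (Fin C))).withDensity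
        fun q => ENNReal.ofReal (dens u q.1 q.2)
  /-- The mixing function: a diffeomorphism onto its image. -/
  mix : (Fin n → ℝ) → Fin d → ℝ
  mix_smooth : ContDiff ℝ ∞ mix
  mix_invertible : ∃ h : (Fin d → ℝ) → Fin n → ℝ,
    ContDiffOn ℝ ∞ h (Set.range mix) ∧ Function.LeftInverse h mix

namespace LatentModel

variable {U : Type w} {n d C : ℕ}

instance instIsProbabilityMeasureNoise (M : LatentModel U n d C) (v : Node n) :
    IsProbabilityMeasure (M.noise v) := M.noise_prob v

/-- The joint law of `(Z, Y)` in the domain `u`. -/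
def law (M : LatentModel U n d C) (u : U) : Measure (Assignment n C) :=
  (Measure.pi M.noise).map (M.sol u)

instance instIsFiniteMeasureLaw (M : LatentModel U n d C) (u : U) : IsFiniteMeasure (M.law u) := by
  unfold law; infer_instance

/-- The joint law of `(X, Y)` in the domain `u`. -/
def obsLaw (M : LatentModel U n d C) (u : U) : Measure ((Fin d → ℝ) × Fin C) :=
  (M.law u).map fun x => (M.mix (latent x), label x)

/-- In the domain `u`, the variables `a` and `b` are conditionally independent given the variables
in `S`. -/
def CondIndepVars (M : LatentModel U n d C) (u : U) (a b : Node n) (S : Set (Node n)) : Prop :=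
  CondIndepFun
    (MeasurableSpace.comap (fun (x : Assignment n C) (s : S) => x s.1) inferInstance)
    (Measurable.comap_le (measurable_pi_lambda _ fun s : S => measurable_pi_apply s.1))
    (fun x : Assignment n C => x a) (fun x : Assignment n C => x b) (M.law u)

/-- Faithfulness: in every domain, the conditional independences of the law of `(Z, Y)` are
d-separations of the graph. -/
def Faithful (M : LatentModel U n d C) : Prop :=
  ∀ (u : U) (a b : Node n) (S : Set (Node n)), a ≠ b → a ∉ S → b ∉ S →
    M.CondIndepVars u a b S → DSep M.edge a b S

/-- The Markov network over `(Z, Y)`: two variables are not adjacent if and only if they are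
conditionally independent given all the other variables (in every domain). -/
def markovNetwork (M : LatentModel U n d C) : SimpleGraph (Node n) where
  Adj a b := a ≠ b ∧ ∃ u, ¬ M.CondIndepVars u a b {a, b}ᶜ
  symm := ⟨fun a b ⟨hab, u, hu⟩ => ⟨hab.symm, u, fun h => hu (by
    rw [Set.pair_comm]; exact CondIndepFun.symm h)⟩⟩
  loopless := ⟨fun a h => h.1 rfl⟩

open scoped Classical in
/-- The latent parents of the label. -/
def parents (M : LatentModel U n d C) : Finset (Fin n) :=
  {i | M.edge (some i) none}

open scoped Classical in
/-- The latent children of the label. -/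
def children (M : LatentModel U n d C) : Finset (Fin n) :=
  {i | M.edge none (some i)}

open scoped Classical in
/-- The spouses of the label: the latent variables that share a child with the label and are
neither parents nor children of the label. -/
def spouses (M : LatentModel U n d C) : Finset (Fin n) :=
  {i | i ∉ M.parents ∧ i ∉ M.children ∧ ∃ j ∈ M.children, M.edge (some i) (some j)}

/-- The Markov blanket of the label: its parents, children and spouses. -/
def blanket (M : LatentModel U n d C) : Finset (Fin n) :=
  M.parents ∪ M.children ∪ M.spouses

/-- `Z_i` is an intimate neighbor of `Z_j`: it is adjacent, in the Markov network, to `Z_j` and to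
all the other neighbors of `Z_j` (including the label, if the label is a neighbor of `Z_j`). -/
def IntimateNeighbor (M : LatentModel U n d C) (i j : Fin n) : Prop :=
  M.markovNetwork.Adj (some i) (some j) ∧
    ∀ a : Node n, M.markovNetwork.Adj a (some j) → a ≠ some i → M.markovNetwork.Adj (some i) a

/-- Group-specific intimate neighbors: the latent intimate neighbors of a parent (respectively
child, spouse) of the label are parents (respectively children, spouses) of the label. -/
def GroupSpecificIntimateNeighbors (M : LatentModel U n d C) : Prop :=
  ∀ i j, M.IntimateNeighbor i j →
    (j ∈ M.parents → i ∈ M.parents) ∧ (j ∈ M.children → i ∈ M.children) ∧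
    (j ∈ M.spouses → i ∈ M.spouses)

/-- The edges `{Z_i, Z_j}`, `i < j`, of the Markov network between latent variables. -/
abbrev LatentEdge (M : LatentModel U n d C) : Type :=
  {e : Fin n × Fin n // e.1 < e.2 ∧ M.markovNetwork.Adj (some e.1) (some e.2)}

/-- `log P^(u)(Z = z, Y = c)` as a function of `z`. -/
def logDens (M : LatentModel U n d C) (u : U) (c : Fin C) (z : Fin n → ℝ) : ℝ :=
  Real.log (M.dens u z c)

/-- The vector of the first derivatives, of the pure second derivatives, and of the mixed second
derivatives along the latent edges, of the logarithm of the density. -/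
def wVec (M : LatentModel U n d C) (c : Fin C) (z : Fin n → ℝ) (u : U) :
    Fin n ⊕ Fin n ⊕ M.LatentEdge → ℝ
  | .inl i => partialDeriv i (M.logDens u c) z
  | .inr (.inl i) => partialDeriv i (partialDeriv i (M.logDens u c)) z
  | .inr (.inr e) => partialDeriv e.1.1 (partialDeriv e.1.2 (M.logDens u c)) z

/-- Sufficient changes for `Z`. -/
def SufficientChangesZ (M : LatentModel U n d C) : Prop :=
  ∀ z : Fin n → ℝ, ∃ (c : Fin C) (u : Fin (2 * n + Nat.card M.LatentEdge + 1) → U),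
    LinearIndependent ℝ fun k : Fin (2 * n + Nat.card M.LatentEdge) =>
      M.wVec c z (u k.succ) - M.wVec c z (u 0)

/-- The vector of the derivatives, with respect to the variables of the Markov blanket, of the
logarithm of the density. -/
def tauVec (M : LatentModel U n d C) (z : Fin n → ℝ) (u : U) (c : Fin C) : M.blanket → ℝ :=
  fun i => partialDeriv i.1 (M.logDens u c) z

/-- Sufficient changes for `Y`. -/
def SufficientChangesY (M : LatentModel U n d C) : Prop :=
  ∀ z : Fin n → ℝ, ∃ (c₁ : Fin C) (u : Fin M.blanket.card → U) (c : Fin M.blanket.card → Fin C),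
    (∀ k, c k ≠ c₁) ∧
      LinearIndependent ℝ fun k => M.tauVec z (u k) (c k) - M.tauVec z (u k) c₁

/-- Two models generate the same observations: their mixing functions have the same image and
the laws of `(X, Y)` agree in every domain. -/
def ObsEquiv (M M' : LatentModel U n d C) : Prop :=
  Set.range M'.mix = Set.range M.mix ∧ ∀ u, M'.obsLaw u = M.obsLaw u

/-- Number of edges of the Markov network over `(Z, Y)`. -/
def edgeCount (M : LatentModel U n d C) : ℕ := M.markovNetwork.edgeSet.ncard

/-- `M'` is a faithful model of the observations generated by `M`, and its Markov network has the
fewest edges among all such models. -/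
def IsMinimalModelOf (M' M : LatentModel U n d C) : Prop :=
  M.ObsEquiv M' ∧ M'.Faithful ∧
    ∀ M'' : LatentModel U n d C, M.ObsEquiv M'' → M''.Faithful → M'.edgeCount ≤ M''.edgeCount

/-- The block `S` of the latent variables of `M'` is an invertible transformation of the block `A`
of the latent variables of `M`: one diffeomorphism maps `Z_A` to `Ẑ_S` whenever `Z` and `Ẑ`
generate the same features. -/
def BlockInvertible (M M' : LatentModel U n d C) (A S : Finset (Fin n)) : Prop :=
  ∃ h : (A → ℝ) ≃ (S → ℝ), ContDiff ℝ ∞ h ∧ ContDiff ℝ ∞ h.symm ∧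
    ∀ z z' : Fin n → ℝ, M'.mix z' = M.mix z → (fun i : S => z' i.1) = h (fun i : A => z i.1)

end LatentModel

end LatentDA

end

open MeasureTheory ProbabilityTheory
open scoped ContDiff

set_option linter.unusedSectionVars false

noncomputable section

/-! Two observationally equivalent models are linked by a diffeomorphism `ψ` from the latents of
`M'` to those of `M`. By change of variables the log-densities of `M'` are those of `M` composed
with `ψ`, up to a log-Jacobian term that depends neither on the domain nor on the label. Differences
of log-densities over domains or labels are therefore transported by plain composition
(`logDens_sub_transition`).

Non-adjacency in a Markov network makes derivatives vanish. For a positive continuous density,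
conditional independence of `a` and `b` given the rest is the cross identity `P(x) P(x_ab) = P(x_a)
P(x_b)`, where the subscripts mark the coordinates replaced by those of a second point
(`cross_identity_of_condIndep`). Hence mixed second derivatives of the log-density vanish for
non-adjacent latents, and label differences have no derivative along a latent not adjacent to `Y`.
When `k, l` are non-adjacent in `M'`, expanding the transported second derivative by the chain rule
gives a linear relation among the vectors `wVec`. Sufficient changes force its coefficients to
vanish, so row `i` of the Jacobian of `ψ` at column `k` times row `j` at column `l` is zero whenever
`i = j` or `i, j` are adjacent in `M` (`jac_mul_jac_eq_zero`). The same argument with labels treats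
adjacency to `Y` (`jac_eq_zero_of_mem_blanket`).

At each point a nonzero term of the Jacobian determinant gives a permutation `σ` which preserves
edges from the network of `M` to that of `M'`. As `M` itself competes in the minimality of `M'`,
edge counting makes `σ` an isomorphism (`adj_iff`). A nonzero entry of row `i` in column `σ j` then
makes `j` equal to `i` or an intimate neighbor of `i`, so the rows of a group closed under intimate
neighbors are supported on its image under `σ`. This support has constant size and is locally
constant by continuity, hence constant on the connected space `ℝⁿ` (`rowSupport_const`), and each
group becomes a diffeomorphic block (`blockInvertible`).

The blocks fill the blanket of `M'` because in a faithful model the blanket is the neighborhood of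
`Y` in the Markov network (`adj_label_iff`). One inclusion uses faithfulness, the other the
factorization of the law along the graph (`law_eq_withDensity_mechDens`). -/

namespace LatentDA

universe w

/-! ### Resampling coordinates of a product of probability measures -/

section Splice

variable {ι : Type*} {α : ι → Type*}

open scoped Classical in
/-- The point with the coordinates of `y` on `T` and those of `x` elsewhere. -/
def splice (T : Set ι) (x y : ∀ i, α i) : ∀ i, α i := fun i => if i ∈ T then y i else x i

lemma splice_of_mem {T : Set ι} (x y : ∀ i, α i) {i : ι} (h : i ∈ T) : splice T x y i = y i :=
  if_pos h

lemma splice_of_notMem {T : Set ι} (x y : ∀ i, α i) {i : ι} (h : i ∉ T) :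
    splice T x y i = x i :=
  if_neg h

lemma splice_congr {T T' : Set ι} (x y : ∀ i, α i) {i : ι} (h : i ∈ T ↔ i ∈ T') :
    splice T x y i = splice T' x y i := by
  by_cases hT : i ∈ T
  · rw [splice_of_mem x y hT, splice_of_mem x y (h.1 hT)]
  · rw [splice_of_notMem x y hT, splice_of_notMem x y fun h' => hT (h.2 h')]

lemma splice_splice (T T' : Set ι) (x y y' : ∀ i, α i) :
    splice T' (splice T x y) y' = splice (T ∪ T') x (splice T' y y') := by
  funext i
  by_cases h' : i ∈ T' <;> by_cases h : i ∈ T <;> simp [splice, h, h']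

variable [∀ i, MeasurableSpace (α i)]

lemma measurable_splice (T : Set ι) :
    Measurable fun p : (∀ i, α i) × (∀ i, α i) => splice T p.1 p.2 := by
  refine measurable_pi_lambda _ fun i => ?_
  by_cases h : i ∈ T <;> simp only [splice, h, if_true, if_false] <;> fun_prop

variable [Fintype ι] (lam : ∀ i, Measure (α i)) [∀ i, IsProbabilityMeasure (lam i)]

/-- Coordinates of a product law are independent, so redrawing some of them from an independent copy
does not change the law. This replaces Fubini over complementary blocks of coordinates without
splitting the product space. -/
lemma map_splice (T : Set ι) :
    ((Measure.pi lam).prod (Measure.pi lam)).map (fun p => splice T p.1 p.2) = Measure.pi lam := by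
  classical
  refine (Measure.pi_eq fun s hs => ?_).symm
  rw [Measure.map_apply (measurable_splice T) (MeasurableSet.univ_pi hs)]
  have : (fun p : (∀ i, α i) × (∀ i, α i) => splice T p.1 p.2) ⁻¹' Set.univ.pi s =
      (Set.univ.pi fun i => if i ∈ T then Set.univ else s i) ×ˢ
        (Set.univ.pi fun i => if i ∈ T then s i else Set.univ) := by
    ext p
    simp only [Set.mem_preimage, Set.mem_pi, Set.mem_univ, true_imp_iff, Set.mem_prod, ← forall_and]
    refine forall_congr' fun i => ?_
    by_cases h : i ∈ T <;> simp [splice, h]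
  rw [this, Measure.prod_prod, Measure.pi_pi, Measure.pi_pi, ← Finset.prod_mul_distrib]
  refine Finset.prod_congr rfl fun i _ => ?_
  by_cases h : i ∈ T <;> simp [h]

lemma ae_splice (T : Set ι) {p : (∀ i, α i) → Prop} (h : ∀ᵐ x ∂Measure.pi lam, p x) :
    ∀ᵐ q ∂(Measure.pi lam).prod (Measure.pi lam), p (splice T q.1 q.2) := by
  rw [← map_splice lam T] at h
  exact ae_of_ae_map (measurable_splice T).aemeasurable h

/-- The average of `F` over the coordinates in `T`. -/
def spliceAvg (T : Set ι) (F : (∀ i, α i) → ENNReal) (x : ∀ i, α i) : ENNReal :=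
  ∫⁻ y, F (splice T x y) ∂Measure.pi lam

variable {F G : (∀ i, α i) → ENNReal}

lemma measurable_spliceAvg (T : Set ι) (hF : Measurable F) : Measurable (spliceAvg lam T F) :=
  (hF.comp (measurable_splice T)).lintegral_prod_right'

lemma lintegral_spliceAvg (T : Set ι) (hF : Measurable F) :
    ∫⁻ x, spliceAvg lam T F x ∂Measure.pi lam = ∫⁻ x, F x ∂Measure.pi lam := by
  conv_rhs => rw [← map_splice lam T, lintegral_map hF (measurable_splice T)]
  exact (lintegral_prod _ (hF.comp (measurable_splice T)).aemeasurable).symm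

lemma dependsOn_spliceAvg {S T : Set ι} (hF : DependsOn F S) :
    DependsOn (spliceAvg lam T F) (S \ T) := by
  intro x x' h
  refine lintegral_congr fun y => hF fun i hi => ?_
  by_cases hT : i ∈ T
  · simp [splice, hT]
  · simp [splice, hT, h i ⟨hi, hT⟩]

lemma dependsOn_compl_spliceAvg (T : Set ι) : DependsOn (spliceAvg lam T F) Tᶜ := by
  rw [Set.compl_eq_univ_sdiff]
  exact dependsOn_spliceAvg lam fun x y h => congrArg F (funext fun i => h i (Set.mem_univ i))

lemma spliceAvg_mul_left {T : Set ι} (hG : DependsOn G Tᶜ) (hF : Measurable F) (x : ∀ i, α i) :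
    spliceAvg lam T (fun x => G x * F x) x = G x * spliceAvg lam T F x := by
  have h : ∀ y, G (splice T x y) = G x := fun y => hG fun i hi => splice_of_notMem x y hi
  unfold spliceAvg
  simp only [h]
  exact lintegral_const_mul _ (hF.comp ((measurable_splice T).comp measurable_prodMk_left))

lemma spliceAvg_mul_right {T : Set ι} (hG : DependsOn G Tᶜ) (hF : Measurable F) (x : ∀ i, α i) :
    spliceAvg lam T (fun x => F x * G x) x = spliceAvg lam T F x * G x := by
  simp only [mul_comm _ (G _)]
  exact spliceAvg_mul_left lam hG hF x

lemma spliceAvg_spliceAvg (T T' : Set ι) (hF : Measurable F) :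
    spliceAvg lam T (spliceAvg lam T' F) = spliceAvg lam (T ∪ T') F := by
  funext x
  unfold spliceAvg
  simp only [splice_splice]
  have hm : Measurable fun y => F (splice (T ∪ T') x y) :=
    hF.comp ((measurable_splice _).comp measurable_prodMk_left)
  conv_rhs => rw [← map_splice lam T', lintegral_map hm (measurable_splice T')]
  exact (lintegral_prod _ (hm.comp (measurable_splice T')).aemeasurable).symm

/-- Averaging over `b` treats `F` as a constant, and averaging over `a` then treats the averaged `G`
as a constant. -/
lemma spliceAvg_pair_mul {a b : ι} (hF : Measurable F) (hG : Measurable G)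
    (hFb : DependsOn F {b}ᶜ) (hGa : DependsOn G {a}ᶜ) (x : ∀ i, α i) :
    spliceAvg lam {a, b} (fun x => F x * G x) x = spliceAvg lam {a} F x * spliceAvg lam {b} G x := by
  have h : ({a, b} : Set ι) = {a} ∪ {b} := rfl
  have hm : Measurable fun x => F x * G x := hF.mul hG
  rw [h, ← spliceAvg_spliceAvg lam _ _ hm]
  have h1 : spliceAvg lam {b} (fun x => F x * G x) = fun x => F x * spliceAvg lam {b} G x :=
    funext fun x => spliceAvg_mul_left lam hFb hG x
  rw [h1]
  exact spliceAvg_mul_right lam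
    (fun x y hxy => dependsOn_spliceAvg lam hGa fun i hi => hxy i hi.1) hF x

/-! ### Conditional independence for laws with a density -/

/-- The σ-algebra generated by the coordinates in `S`. -/
abbrev coordSigma (α : ι → Type*) [∀ i, MeasurableSpace (α i)] (S : Set ι) :
    MeasurableSpace (∀ i, α i) :=
  MeasurableSpace.comap (fun (x : ∀ i, α i) (s : S) => x s.1) inferInstance

lemma coordSigma_le (S : Set ι) : coordSigma α S ≤ MeasurableSpace.pi :=
  Measurable.comap_le (measurable_pi_lambda _ fun s : S => measurable_pi_apply s.1)

lemma dependsOn_indicator {S : Set ι} {B : Set (∀ i, α i)} (hB : MeasurableSet[coordSigma α S] B)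
    (c : ENNReal) : DependsOn (B.indicator fun _ => c) S := by
  obtain ⟨B', -, rfl⟩ := hB
  intro x y h
  have h' : (fun s : S => x s.1) = fun s : S => y s.1 := funext fun s => h s.1 s.2
  have h'' : x ∈ (fun (x : ∀ i, α i) (s : S) => x s.1) ⁻¹' B' ↔
      y ∈ (fun (x : ∀ i, α i) (s : S) => x s.1) ⁻¹' B' := by
    rw [Set.mem_preimage, Set.mem_preimage, h']
  by_cases hx : x ∈ (fun (x : ∀ i, α i) (s : S) => x s.1) ⁻¹' B'
  · rw [Set.indicator_of_mem hx, Set.indicator_of_mem (h''.1 hx)]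
  · rw [Set.indicator_of_notMem hx, Set.indicator_of_notMem fun h => hx (h''.2 h)]

lemma measurable_coordSigma_spliceAvg (T : Set ι) (hF : Measurable F) :
    Measurable[coordSigma α Tᶜ] (spliceAvg lam T F) := by
  classical
  let e : ((∀ s : (Tᶜ : Set ι), α s.1) × (∀ i, α i)) → ∀ i, α i :=
    fun p i => if h : i ∈ T then p.2 i else p.1 ⟨i, h⟩
  have he : Measurable e := by
    refine measurable_pi_lambda _ fun i => ?_
    by_cases h : i ∈ T <;> simp only [e, h, dite_true, dite_false]
    · fun_prop
    · exact (measurable_pi_apply (⟨i, h⟩ : (Tᶜ : Set ι))).comp measurable_fst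
  have hm : Measurable fun r => ∫⁻ y, F (e (r, y)) ∂Measure.pi lam :=
    (hF.comp he).lintegral_prod_right'
  have : spliceAvg lam T F = (fun r => ∫⁻ y, F (e (r, y)) ∂Measure.pi lam) ∘
      fun (x : ∀ i, α i) (s : (Tᶜ : Set ι)) => x s.1 := by
    funext x
    refine lintegral_congr fun y => congrArg F (funext fun i => ?_)
    by_cases h : i ∈ T <;> simp [splice, e, h]
  rw [this]
  exact hm.comp (comap_measurable _)

lemma ae_spliceAvg_lt_top (T : Set ι) (hF : Measurable F)
    (hfin : ∫⁻ x, F x ∂Measure.pi lam ≠ ⊤) : ∀ᵐ x ∂Measure.pi lam, spliceAvg lam T F x < ⊤ :=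
  ae_lt_top (measurable_spliceAvg lam T hF) (by rwa [lintegral_spliceAvg lam T hF])

/-- The zero set of the average does not involve the coordinates in `T`, so its indicator can be
pulled out of the average of `f`, where it multiplies zero. -/
lemma ae_spliceAvg_ne_zero {f : (∀ i, α i) → ENNReal} (hf : Measurable f) (T : Set ι) :
    ∀ᵐ x ∂(Measure.pi lam).withDensity f, spliceAvg lam T f x ≠ 0 := by
  have hm := measurable_spliceAvg lam T hf
  have hB : MeasurableSet {x | spliceAvg lam T f x = 0} := hm (measurableSet_singleton 0)
  have hd : DependsOn ({x | spliceAvg lam T f x = 0}.indicator fun _ => (1 : ENNReal)) Tᶜ := by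
    intro x y h
    simp only [Set.indicator, Set.mem_ofPred_eq, dependsOn_compl_spliceAvg lam T h]
  rw [ae_iff]
  simp only [not_not]
  rw [withDensity_apply _ hB, ← lintegral_indicator hB]
  have h1 : ({x | spliceAvg lam T f x = 0}.indicator fun x => f x) =
      fun x => ({x | spliceAvg lam T f x = 0}.indicator fun _ => (1 : ENNReal)) x * f x := by
    funext x
    by_cases hx : x ∈ {x | spliceAvg lam T f x = 0} <;> simp [Set.indicator, hx]
  have hm1 : Measurable fun x =>
      {x | spliceAvg lam T f x = 0}.indicator (fun _ => (1 : ENNReal)) x * f x :=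
    (measurable_const.indicator hB).mul hf
  rw [h1, ← lintegral_spliceAvg lam T hm1]
  simp only [spliceAvg_mul_left lam hd hf]
  simp only [Set.indicator, Set.mem_ofPred_eq]
  refine (lintegral_congr fun x => ?_).trans lintegral_zero
  by_cases hx : spliceAvg lam T f x = 0 <;> simp [hx]

lemma indicator_one_mul_eq {β : Type*} (E : Set β) (f : β → ENNReal) :
    (fun x => E.indicator (fun _ => 1) x * f x) = E.indicator f := by
  funext x
  by_cases hx : x ∈ E <;> simp [hx]

lemma spliceAvg_mono {T : Set ι} (h : ∀ x, F x ≤ G x) (x : ∀ i, α i) :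
    spliceAvg lam T F x ≤ spliceAvg lam T G x :=
  lintegral_mono fun _ => h _

/-- Bayes' formula. Against a test set that does not involve `T`, the density `f` may be replaced by
its average over `T`, which cancels the denominator. -/
lemma condExp_indicator_withDensity {f : (∀ i, α i) → ENNReal} (hf : Measurable f)
    [IsFiniteMeasure ((Measure.pi lam).withDensity f)] (T : Set ι) {E : Set (∀ i, α i)}
    (hE : MeasurableSet E) :
    ((Measure.pi lam).withDensity f)⟦E | coordSigma α Tᶜ⟧ =ᵐ[(Measure.pi lam).withDensity f]
      fun x => (spliceAvg lam T (E.indicator f) x / spliceAvg lam T f x).toReal := by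
  set μ := (Measure.pi lam).withDensity f with hμ
  have hfin : ∫⁻ x, f x ∂Measure.pi lam ≠ ⊤ := by
    have := measure_ne_top μ Set.univ
    rwa [hμ, withDensity_apply _ MeasurableSet.univ, Measure.restrict_univ] at this
  have hle : ∀ x, spliceAvg lam T (E.indicator f) x ≤ spliceAvg lam T f x :=
    spliceAvg_mono lam fun x => Set.indicator_le_self _ _ x
  have hk1 : ∀ x, spliceAvg lam T (E.indicator f) x / spliceAvg lam T f x ≤ 1 := fun x =>
    ENNReal.div_le_of_le_mul (by simpa using hle x)
  have hmk : Measurable[coordSigma α Tᶜ]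
      fun x => spliceAvg lam T (E.indicator f) x / spliceAvg lam T f x :=
    Measurable.div (m := coordSigma α Tᶜ)
      (measurable_coordSigma_spliceAvg lam T (hf.indicator hE))
      (measurable_coordSigma_spliceAvg lam T hf)
  have hmk' := hmk.mono (coordSigma_le Tᶜ) le_rfl
  have hb : ∀ x, ‖(spliceAvg lam T (E.indicator f) x / spliceAvg lam T f x).toReal‖ ≤ 1 := by
    intro x
    rw [Real.norm_of_nonneg ENNReal.toReal_nonneg]
    exact ENNReal.toReal_mono ENNReal.one_ne_top (hk1 x)
  symm
  refine ae_eq_condExp_of_forall_setIntegral_eq (coordSigma_le Tᶜ)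
    ((integrable_const (1 : ℝ)).indicator hE) (fun s _ _ => ?_) (fun B hB _ => ?_) ?_
  · exact (Integrable.of_bound hmk'.ennreal_toReal.aestronglyMeasurable 1
      (Filter.Eventually.of_forall hb)).integrableOn
  · have hB' : MeasurableSet B := coordSigma_le Tᶜ B hB
    rw [integral_toReal hmk'.aemeasurable
      (Filter.Eventually.of_forall fun x => (hk1 x).trans_lt ENNReal.one_lt_top),
      integral_indicator_const _ hE, smul_eq_mul, mul_one, Measure.real,
      Measure.restrict_apply hE]
    congr 1
    have h1 : ∫⁻ x in B, spliceAvg lam T (E.indicator f) x / spliceAvg lam T f x ∂μ =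
        ∫⁻ x, (B.indicator (fun _ => 1) x *
          (spliceAvg lam T (E.indicator f) x / spliceAvg lam T f x)) * f x ∂Measure.pi lam := by
      rw [← lintegral_indicator hB', hμ, lintegral_withDensity_eq_lintegral_mul _ hf
        (hmk'.indicator hB'), ← indicator_one_mul_eq]
      exact lintegral_congr fun x => mul_comm _ _
    have hdep : DependsOn (fun x => B.indicator (fun _ => (1 : ENNReal)) x *
        (spliceAvg lam T (E.indicator f) x / spliceAvg lam T f x)) Tᶜ := by
      intro x y h
      have h1 := dependsOn_indicator hB 1 h
      have h2 := dependsOn_compl_spliceAvg lam T (F := f) h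
      have h3 := dependsOn_compl_spliceAvg lam T (F := E.indicator f) h
      simp only [h1, h2, h3]
    have hm1 : Measurable fun x => (B.indicator (fun _ => (1 : ENNReal)) x *
        (spliceAvg lam T (E.indicator f) x / spliceAvg lam T f x)) * f x :=
      ((measurable_const.indicator hB').mul hmk').mul hf
    rw [h1, ← lintegral_spliceAvg lam T hm1]
    simp only [spliceAvg_mul_left lam hdep hf]
    have h2 : ∫⁻ x, B.indicator (fun _ => 1) x *
        (spliceAvg lam T (E.indicator f) x / spliceAvg lam T f x) * spliceAvg lam T f x
          ∂Measure.pi lam = ∫⁻ x, B.indicator (fun _ => 1) x * spliceAvg lam T (E.indicator f) x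
          ∂Measure.pi lam := by
      refine lintegral_congr_ae ?_
      filter_upwards [ae_spliceAvg_lt_top lam T hf hfin] with x hx
      -- A zero denominator forces a zero numerator, which it dominates; an infinite one occurs only
      -- on a null set.
      rw [mul_assoc, ENNReal.div_mul_cancel' (fun h => le_antisymm (h ▸ hle x) zero_le)
        (fun h => absurd h hx.ne)]
    rw [h2]
    simp only [← spliceAvg_mul_left lam (dependsOn_indicator hB 1) (hf.indicator hE)]
    have hm2 : Measurable fun x => B.indicator (fun _ => (1 : ENNReal)) x * E.indicator f x :=
      (measurable_const.indicator hB').mul (hf.indicator hE)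
    rw [lintegral_spliceAvg lam T hm2, hμ,
      withDensity_apply _ (hE.inter hB'), ← lintegral_indicator (hE.inter hB'),
      indicator_one_mul_eq, Set.indicator_indicator, Set.inter_comm]
  · exact hmk.ennreal_toReal.stronglyMeasurable.aestronglyMeasurable

end Splice

section CondIndep

variable {ι : Type*} {α : ι → Type*} [∀ i, MeasurableSpace (α i)] [Fintype ι]
  (lam : ∀ i, Measure (α i)) [∀ i, IsProbabilityMeasure (lam i)]
  {f g h : (∀ i, α i) → ENNReal} {a b : ι}

/-- The indicator of a set of values of one coordinate. -/
def coordInd (i : ι) (s : Set (α i)) (x : ∀ i, α i) : ENNReal := s.indicator (fun _ => 1) (x i)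

lemma measurable_coordInd (i : ι) {s : Set (α i)} (hs : MeasurableSet s) :
    Measurable (coordInd i s) :=
  (measurable_const.indicator hs).comp (measurable_pi_apply i)

lemma dependsOn_coordInd {i : ι} (s : Set (α i)) {S : Set ι} (hi : i ∈ S) :
    DependsOn (coordInd i s) S := fun x y hxy => by
  simp only [coordInd, hxy i hi]

lemma indicator_coord (i : ι) (s : Set (α i)) :
    ((fun x : ∀ i, α i => x i) ⁻¹' s).indicator f = fun x => coordInd i s x * f x := by
  funext x
  by_cases hx : x i ∈ s <;> simp [Set.indicator, coordInd, hx]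

lemma indicator_coord_inter (s : Set (α a)) (t : Set (α b)) :
    ((fun x : ∀ i, α i => x a) ⁻¹' s ∩ (fun x : ∀ i, α i => x b) ⁻¹' t).indicator f =
      fun x => coordInd a s x * (coordInd b t x * f x) := by
  funext x
  by_cases hx : x a ∈ s <;> by_cases hy : x b ∈ t <;> simp [Set.indicator, coordInd, hx, hy]

lemma lintegral_ne_top_of_isFiniteMeasure_withDensity
    [IsFiniteMeasure ((Measure.pi lam).withDensity f)] : ∫⁻ x, f x ∂Measure.pi lam ≠ ⊤ := by
  have := measure_ne_top ((Measure.pi lam).withDensity f) Set.univ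
  rwa [withDensity_apply _ MeasurableSet.univ, Measure.restrict_univ] at this

/-- The product rule for conditional probabilities, with each of them written by Bayes' formula and
the common denominator, almost surely positive and finite, multiplied out. -/
lemma condIndep_coord_iff [∀ i, StandardBorelSpace (α i)] (hf : Measurable f)
    [IsFiniteMeasure ((Measure.pi lam).withDensity f)] :
    CondIndepFun (coordSigma α {a, b}ᶜ) (coordSigma_le _) (fun x : ∀ i, α i => x a)
        (fun x => x b) ((Measure.pi lam).withDensity f) ↔
      ∀ (s : Set (α a)) (t : Set (α b)), MeasurableSet s → MeasurableSet t →
        (fun x => spliceAvg lam {a, b} (fun x => coordInd a s x * (coordInd b t x * f x)) x *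
          spliceAvg lam {a, b} f x) =ᵐ[(Measure.pi lam).withDensity f]
        fun x => spliceAvg lam {a, b} (fun x => coordInd a s x * f x) x *
          spliceAvg lam {a, b} (fun x => coordInd b t x * f x) x := by
  rw [condIndepFun_iff_condExp_inter_preimage_eq_mul (measurable_pi_apply a)
    (measurable_pi_apply b)]
  refine forall_congr' fun s => forall_congr' fun t => forall_congr' fun hs =>
    forall_congr' fun ht => ?_
  have ha := measurable_pi_apply (X := α) a hs
  have hb := measurable_pi_apply (X := α) b ht
  have e1 := condExp_indicator_withDensity lam hf {a, b} (ha.inter hb)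
  have e2 := condExp_indicator_withDensity lam hf {a, b} ha
  have e3 := condExp_indicator_withDensity lam hf {a, b} hb
  have hlt := (withDensity_absolutelyContinuous (Measure.pi lam) f).ae_le
    (ae_spliceAvg_lt_top lam {a, b} hf (lintegral_ne_top_of_isFiniteMeasure_withDensity lam))
  have hne := ae_spliceAvg_ne_zero lam hf {a, b}
  have key : ∀ A B C D : ENNReal, D ≠ 0 → D < ⊤ → A ≤ D → B ≤ D → C ≤ D →
      ((A / D).toReal = (B / D).toReal * (C / D).toReal ↔ A * D = B * C) := by
    intro A B C D h0 ht hA hB hC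
    lift D to NNReal using ht.ne
    lift A to NNReal using (hA.trans_lt ht).ne
    lift B to NNReal using (hB.trans_lt ht).ne
    lift C to NNReal using (hC.trans_lt ht).ne
    have h0' : (D : ℝ) ≠ 0 := by exact_mod_cast h0
    simp only [ENNReal.toReal_div, ENNReal.coe_toReal]
    rw [div_mul_div_comm, div_eq_div_iff h0' (mul_ne_zero h0' h0'), ← mul_assoc,
      mul_left_inj' h0']
    exact_mod_cast Iff.rfl
  have hle : ∀ (E : Set (∀ i, α i)) x, spliceAvg lam {a, b} (E.indicator f) x ≤
      spliceAvg lam {a, b} f x :=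
    fun E => spliceAvg_mono lam fun x => Set.indicator_le_self _ _ x
  rw [← indicator_coord_inter, ← indicator_coord, ← indicator_coord]
  constructor
  · intro hc
    filter_upwards [e1, e2, e3, hlt, hne, hc] with x h1 h2 h3 h4 h5 h6
    rw [h1, h2, h3] at h6
    exact (key _ _ _ _ h5 h4 (hle _ x) (hle _ x) (hle _ x)).1 h6
  · intro hc
    filter_upwards [e1, e2, e3, hlt, hne, hc] with x h1 h2 h3 h4 h5 h6
    rw [h1, h2, h3]
    exact (key _ _ _ _ h5 h4 (hle _ x) (hle _ x) (hle _ x)).2 h6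

/-- A factorization of the density gives conditional independence. -/
lemma condIndep_of_factorization [∀ i, StandardBorelSpace (α i)] (hab : a ≠ b)
    (hg : Measurable g) (hh : Measurable h) (hgb : DependsOn g {b}ᶜ) (hha : DependsOn h {a}ᶜ)
    [IsFiniteMeasure ((Measure.pi lam).withDensity fun x => g x * h x)] :
    CondIndepFun (coordSigma α {a, b}ᶜ) (coordSigma_le _) (fun x : ∀ i, α i => x a)
        (fun x => x b) ((Measure.pi lam).withDensity fun x => g x * h x) := by
  have hgh : Measurable fun x => g x * h x := hg.mul hh
  rw [condIndep_coord_iff lam hgh]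
  intro s t hs ht
  refine Filter.Eventually.of_forall fun x => ?_
  have hsb := dependsOn_coordInd s (S := {b}ᶜ) hab
  have hta := dependsOn_coordInd t (S := {a}ᶜ) hab.symm
  have ms := (measurable_coordInd a hs).mul hg
  have mt := (measurable_coordInd b ht).mul hh
  have ds : DependsOn (fun x => coordInd a s x * g x) {b}ᶜ := fun x y hxy => by
    simp only [hsb hxy, hgb hxy]
  have dt : DependsOn (fun x => coordInd b t x * h x) {a}ᶜ := fun x y hxy => by
    simp only [hta hxy, hha hxy]
  have h1 := spliceAvg_pair_mul lam ms mt ds dt x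
  have h2 := spliceAvg_pair_mul lam ms hh ds hha x
  have h3 := spliceAvg_pair_mul lam hg mt hgb dt x
  have h4 := spliceAvg_pair_mul lam hg hh hgb hha x
  have r1 : (fun x => coordInd a s x * (coordInd b t x * (g x * h x))) =
      fun x => (coordInd a s x * g x) * (coordInd b t x * h x) := by funext x; ring
  have r2 : (fun x => coordInd a s x * (g x * h x)) =
      fun x => (coordInd a s x * g x) * h x := by funext x; ring
  have r3 : (fun x => coordInd b t x * (g x * h x)) =
      fun x => g x * (coordInd b t x * h x) := by funext x; ring
  simp only [Pi.mul_apply] at h1 h2 h3 h4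
  beta_reduce
  rw [r1, r2, r3, h1, h2, h3, h4]
  ring

/-- The weight `r` is chosen before `f`. Two densities can thus be compared on rectangles through
their averages over the pair `a, b` alone. -/
lemma withDensity_rectangle (hab : a ≠ b) {s : ∀ i, Set (α i)}
    (hs : ∀ i, MeasurableSet (s i)) :
    ∃ r : (∀ i, α i) → ENNReal, ∀ {f : (∀ i, α i) → ENNReal}, Measurable f →
      (Measure.pi lam).withDensity f (Set.univ.pi s) =
        ∫⁻ x, r x * spliceAvg lam {a, b}
          (fun x => coordInd a (s a) x * (coordInd b (s b) x * f x)) x ∂Measure.pi lam := by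
  classical
  have hms : MeasurableSet (Set.univ.pi s) := MeasurableSet.univ_pi hs
  have hmr : Measurable fun x : ∀ i, α i => ∏ i ∈ ({a, b}ᶜ : Finset ι), coordInd i (s i) x :=
    Finset.measurable_prod _ fun i _ => measurable_coordInd i (hs i)
  have hdr : DependsOn (fun x : ∀ i, α i => ∏ i ∈ ({a, b}ᶜ : Finset ι), coordInd i (s i) x)
      {a, b}ᶜ := by
    intro x y hxy
    refine Finset.prod_congr rfl fun i hi => dependsOn_coordInd (s i) (S := {a, b}ᶜ) ?_ hxy
    simpa using hi
  refine ⟨fun x => ∏ i ∈ ({a, b}ᶜ : Finset ι), coordInd i (s i) x, fun {f} hf => ?_⟩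
  have hmf : Measurable fun x => coordInd a (s a) x * (coordInd b (s b) x * f x) :=
    (measurable_coordInd a (hs a)).mul ((measurable_coordInd b (hs b)).mul hf)
  have hmrf : Measurable fun x => (∏ i ∈ ({a, b}ᶜ : Finset ι), coordInd i (s i) x) *
      (coordInd a (s a) x * (coordInd b (s b) x * f x)) := hmr.mul hmf
  simp only [← spliceAvg_mul_left lam hdr hmf]
  rw [lintegral_spliceAvg lam _ hmrf, withDensity_apply _ hms, ← lintegral_indicator hms]
  refine lintegral_congr fun x => ?_
  have hprod : (∏ i ∈ ({a, b}ᶜ : Finset ι), coordInd i (s i) x) *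
      (coordInd a (s a) x * (coordInd b (s b) x)) = ∏ i, coordInd i (s i) x := by
    rw [← Finset.prod_compl_mul_prod ({a, b} : Finset ι), Finset.prod_pair hab]
  have hind : (∏ i, coordInd i (s i) x) = (Set.univ.pi s).indicator (fun _ => 1) x := by
    by_cases hx : x ∈ Set.univ.pi s
    · rw [Set.indicator_of_mem hx]
      exact Finset.prod_eq_one fun i _ => Set.indicator_of_mem (hx i (Set.mem_univ i)) _
    · rw [Set.indicator_of_notMem hx]
      simp only [Set.mem_pi, Set.mem_univ, true_imp_iff, not_forall] at hx
      obtain ⟨i, hi⟩ := hx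
      exact Finset.prod_eq_zero (Finset.mem_univ i) (Set.indicator_of_notMem hi _)
  rw [← indicator_one_mul_eq]
  beta_reduce
  rw [← hind, ← hprod]
  ring

/-- Conditional independence gives a factorization of a positive density. -/
lemma ae_factorization_of_condIndep [∀ i, StandardBorelSpace (α i)] (hab : a ≠ b)
    (hf : Measurable f) (hpos : ∀ x, f x ≠ 0)
    [IsFiniteMeasure ((Measure.pi lam).withDensity f)]
    (hc : CondIndepFun (coordSigma α {a, b}ᶜ) (coordSigma_le _) (fun x : ∀ i, α i => x a)
        (fun x => x b) ((Measure.pi lam).withDensity f)) :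
    ∀ᵐ x ∂Measure.pi lam, f x * spliceAvg lam {a, b} f x =
      spliceAvg lam {b} f x * spliceAvg lam {a} f x ∧
      spliceAvg lam {a, b} f x ≠ 0 ∧ spliceAvg lam {a, b} f x ≠ ⊤ := by
  rw [condIndep_coord_iff lam hf] at hc
  -- Positivity of `f` turns statements almost everywhere for the law into statements almost
  -- everywhere for the reference measure.
  have hac : Measure.pi lam ≪ (Measure.pi lam).withDensity f :=
    withDensity_absolutelyContinuous' hf.aemeasurable (Filter.Eventually.of_forall hpos)
  have hfin := lintegral_ne_top_of_isFiniteMeasure_withDensity lam (f := f)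
  have hlt := ae_spliceAvg_lt_top lam {a, b} hf hfin
  have hne := hac.ae_le (ae_spliceAvg_ne_zero lam hf {a, b})
  have mab := measurable_spliceAvg lam {a, b} hf
  have ma := measurable_spliceAvg lam {a} hf
  have mb := measurable_spliceAvg lam {b} hf
  -- The density expected under conditional independence: the marginal without `b` times the
  -- marginal without `a`, divided by the marginal without both. It is compared with `f` on
  -- rectangles.
  set q : (∀ i, α i) → ENNReal := fun x =>
    (spliceAvg lam {b} f x * spliceAvg lam {a} f x) * (spliceAvg lam {a, b} f x)⁻¹ with hq
  have hmq : Measurable q := (mb.mul ma).mul mab.inv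
  have hdinv : DependsOn (fun x => (spliceAvg lam {a, b} f x)⁻¹) {a, b}ᶜ := fun x y hxy => by
    simp only [dependsOn_compl_spliceAvg lam {a, b} hxy]
  have hrect : ∀ s : ∀ i, Set (α i), (∀ i, MeasurableSet (s i)) →
      (Measure.pi lam).withDensity f (Set.univ.pi s) =
        (Measure.pi lam).withDensity q (Set.univ.pi s) := by
    intro s hs
    obtain ⟨r, hr⟩ := withDensity_rectangle lam hab hs
    rw [hr hf, hr hmq]
    refine lintegral_congr_ae ?_
    have hms := measurable_coordInd a (hs a)
    have hmt := measurable_coordInd b (hs b)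
    filter_upwards [hlt, hne, hac.ae_le (hc (s a) (s b) (hs a) (hs b))] with x h1 h2 h3
    congr 1
    have e1 : (fun x => coordInd a (s a) x * (coordInd b (s b) x * q x)) = fun x =>
        ((coordInd a (s a) x * spliceAvg lam {b} f x) *
          (coordInd b (s b) x * spliceAvg lam {a} f x)) * (spliceAvg lam {a, b} f x)⁻¹ := by
      funext x; simp only [hq]; ring
    have dsb := dependsOn_coordInd (s a) (S := {b}ᶜ) hab
    have dta := dependsOn_coordInd (s b) (S := {a}ᶜ) hab.symm
    have d1 : DependsOn (fun x => coordInd a (s a) x * spliceAvg lam {b} f x) {b}ᶜ :=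
      fun x y hxy => by simp only [dsb hxy, dependsOn_compl_spliceAvg lam {b} hxy]
    have d2 : DependsOn (fun x => coordInd b (s b) x * spliceAvg lam {a} f x) {a}ᶜ :=
      fun x y hxy => by simp only [dta hxy, dependsOn_compl_spliceAvg lam {a} hxy]
    have m1 : Measurable fun x => coordInd a (s a) x * spliceAvg lam {b} f x := hms.mul mb
    have m2 : Measurable fun x => coordInd b (s b) x * spliceAvg lam {a} f x := hmt.mul ma
    have m3 : Measurable fun x => coordInd a (s a) x * f x := hms.mul hf
    have m4 : Measurable fun x => coordInd b (s b) x * f x := hmt.mul hf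
    have e2 : (fun x => coordInd a (s a) x * spliceAvg lam {b} f x) =
        spliceAvg lam {b} (fun x => coordInd a (s a) x * f x) :=
      funext fun x => (spliceAvg_mul_left lam dsb hf x).symm
    have e3 : (fun x => coordInd b (s b) x * spliceAvg lam {a} f x) =
        spliceAvg lam {a} (fun x => coordInd b (s b) x * f x) :=
      funext fun x => (spliceAvg_mul_left lam dta hf x).symm
    have m5 : Measurable fun x => (coordInd a (s a) x * spliceAvg lam {b} f x) *
          (coordInd b (s b) x * spliceAvg lam {a} f x) := m1.mul m2
    rw [e1, spliceAvg_mul_right lam hdinv m5, spliceAvg_pair_mul lam m1 m2 d1 d2, e2, e3,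
      spliceAvg_spliceAvg lam _ _ m3, spliceAvg_spliceAvg lam _ _ m4, Set.union_comm {b} {a}]
    change _ = spliceAvg lam {a, b} _ x * spliceAvg lam {a, b} _ x * _
    rw [← h3, mul_assoc, ENNReal.mul_inv_cancel h2 h1.ne, mul_one]
  have heq : (Measure.pi lam).withDensity f = (Measure.pi lam).withDensity q :=
    ext_of_generate_finite _ generateFrom_pi.symm isPiSystem_pi
      (by rintro _ ⟨s, hs, rfl⟩; exact hrect s fun i => hs i (Set.mem_univ i))
      (by simpa using hrect (fun _ => Set.univ) fun _ => MeasurableSet.univ)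
  rw [withDensity_eq_iff hf.aemeasurable hmq.aemeasurable hfin] at heq
  filter_upwards [heq, hlt, hne] with x h1 h2 h3
  refine ⟨?_, h3, h2.ne⟩
  rw [h1]
  simp only [hq]
  rw [mul_assoc, ENNReal.inv_mul_cancel h3 h2.ne, mul_one]

/-- The factorization is evaluated at `x` and at its three splices. Each marginal ignores the
coordinate averaged out, so both sides of the identity become the same product of four marginals. -/
lemma ae_cross_identity_of_condIndep [∀ i, StandardBorelSpace (α i)] (hab : a ≠ b)
    (hf : Measurable f) (hpos : ∀ x, f x ≠ 0)
    [IsFiniteMeasure ((Measure.pi lam).withDensity f)]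
    (hc : CondIndepFun (coordSigma α {a, b}ᶜ) (coordSigma_le _) (fun x : ∀ i, α i => x a)
        (fun x => x b) ((Measure.pi lam).withDensity f)) :
    ∀ᵐ q ∂(Measure.pi lam).prod (Measure.pi lam), f q.1 * f (splice {a, b} q.1 q.2) =
      f (splice {a} q.1 q.2) * f (splice {b} q.1 q.2) := by
  have hae := ae_factorization_of_condIndep lam hab hf hpos hc
  have h0 : ∀ x y : ∀ i, α i, splice ∅ x y = x := fun x y => funext fun i => by simp [splice]
  filter_upwards [ae_splice lam ∅ hae, ae_splice lam {a, b} hae, ae_splice lam {a} hae,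
    ae_splice lam {b} hae] with ⟨x, y⟩ h1 h2 h3 h4
  simp only [h0] at h1 h2 h3 h4 ⊢
  obtain ⟨h1, hne, hnt⟩ := h1
  replace h2 := h2.1
  replace h3 := h3.1
  replace h4 := h4.1
  have d : ∀ T : Set ι, T ⊆ {a, b} →
      spliceAvg lam {a, b} f (splice T x y) = spliceAvg lam {a, b} f x := fun T hT =>
    dependsOn_compl_spliceAvg lam {a, b} fun i hi => splice_of_notMem x y fun h => hi (hT h)
  rw [d _ subset_rfl] at h2
  rw [d _ (by simp)] at h3 h4
  have c1 : spliceAvg lam {a} f (splice {a, b} x y) = spliceAvg lam {a} f (splice {b} x y) :=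
    dependsOn_compl_spliceAvg lam {a} fun i hi => by
      exact splice_congr x y ⟨fun h => h.resolve_left hi, Or.inr⟩
  have c2 : spliceAvg lam {b} f (splice {a, b} x y) = spliceAvg lam {b} f (splice {a} x y) :=
    dependsOn_compl_spliceAvg lam {b} fun i hi => by
      exact splice_congr x y ⟨fun h => h.resolve_right hi, Or.inl⟩
  have c3 : spliceAvg lam {a} f (splice {a} x y) = spliceAvg lam {a} f x :=
    dependsOn_compl_spliceAvg lam {a} fun i hi => splice_of_notMem x y hi
  have c4 : spliceAvg lam {b} f (splice {b} x y) = spliceAvg lam {b} f x :=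
    dependsOn_compl_spliceAvg lam {b} fun i hi => splice_of_notMem x y hi
  rw [c1, c2] at h2
  rw [c3] at h3
  rw [c4] at h4
  set D := spliceAvg lam {a, b} f x
  have : (f x * D) * (f (splice {a, b} x y) * D) =
      (f (splice {a} x y) * D) * (f (splice {b} x y) * D) := by
    rw [h1, h2, h3, h4]; ring
  have h5 : (f x * f (splice {a, b} x y)) * (D * D) =
      (f (splice {a} x y) * f (splice {b} x y)) * (D * D) := by
    calc _ = (f x * D) * (f (splice {a, b} x y) * D) := by ring
      _ = _ := this
      _ = _ := by ring
  exact (ENNReal.mul_left_inj (mul_ne_zero hne hne) (ENNReal.mul_ne_top hnt hnt)).1 h5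

lemma continuous_splice [∀ i, TopologicalSpace (α i)] (T : Set ι) :
    Continuous fun p : (∀ i, α i) × (∀ i, α i) => splice T p.1 p.2 := by
  refine continuous_pi fun i => ?_
  by_cases h : i ∈ T <;> simp only [splice, h, if_true, if_false] <;> fun_prop

/-- Conditional independence of two coordinates, for a law with the density `P * ∏ i, wt i`, with
`P` continuous and positive. -/
lemma cross_identity_of_condIndep [∀ i, StandardBorelSpace (α i)]
    [∀ i, TopologicalSpace (α i)] [((Measure.pi lam).prod (Measure.pi lam)).IsOpenPosMeasure]
    (hab : a ≠ b) {P : (∀ i, α i) → ℝ}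
    {wt : ∀ i, α i → ENNReal} (hP : Continuous P) (hPm : Measurable P) (hP0 : ∀ x, 0 < P x)
    (hwt : ∀ i, Measurable (wt i))
    (hwt0 : ∀ i x, wt i x ≠ 0) (hwtt : ∀ i x, wt i x ≠ ⊤)
    [IsFiniteMeasure ((Measure.pi lam).withDensity
      fun x => ENNReal.ofReal (P x) * ∏ i, wt i (x i))]
    (hc : CondIndepFun (coordSigma α {a, b}ᶜ) (coordSigma_le _) (fun x : ∀ i, α i => x a)
        (fun x => x b) ((Measure.pi lam).withDensity
          fun x => ENNReal.ofReal (P x) * ∏ i, wt i (x i))) (x y : ∀ i, α i) :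
    P x * P (splice {a, b} x y) = P (splice {a} x y) * P (splice {b} x y) := by
  have hf : Measurable fun x => ENNReal.ofReal (P x) * ∏ i, wt i (x i) :=
    hPm.ennreal_ofReal.mul
      (Finset.measurable_prod _ fun i _ => (hwt i).comp (measurable_pi_apply i))
  have hpos : ∀ x, ENNReal.ofReal (P x) * ∏ i, wt i (x i) ≠ 0 := fun x =>
    mul_ne_zero (by simpa using hP0 x) (Finset.prod_ne_zero_iff.2 fun i _ => hwt0 i _)
  have hae := ae_cross_identity_of_condIndep lam hab hf hpos hc
  -- At each coordinate both sides multiply the same two weights, possibly in the other order, so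
  -- the weights cancel from the identity.
  have hW : ∀ x y : ∀ i, α i, (∏ i, wt i (x i)) * ∏ i, wt i (splice {a, b} x y i) =
      (∏ i, wt i (splice {a} x y i)) * ∏ i, wt i (splice {b} x y i) := by
    intro x y
    rw [← Finset.prod_mul_distrib, ← Finset.prod_mul_distrib]
    refine Finset.prod_congr rfl fun i _ => ?_
    by_cases ha : i ∈ ({a} : Set ι)
    · have hb : i ∉ ({b} : Set ι) := fun h => hab (Eq.trans (Eq.symm ha) h)
      rw [splice_of_mem _ _ (show i ∈ ({a, b} : Set ι) from Or.inl ha), splice_of_mem _ _ ha, splice_of_notMem _ _ hb, mul_comm]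
    · rw [splice_of_notMem _ _ ha, 
        splice_congr x y (T := {a, b}) (T' := {b}) ⟨fun h => Or.resolve_left h ha, Or.inr⟩]
  have hWt : ∀ x : ∀ i, α i, (∏ i, wt i (x i)) ≠ ⊤ := fun x =>
    ENNReal.prod_ne_top fun i _ => hwtt i _
  have hW0 : ∀ x : ∀ i, α i, (∏ i, wt i (x i)) ≠ 0 := fun x =>
    Finset.prod_ne_zero_iff.2 fun i _ => hwt0 i _
  have hae' : (fun q : (∀ i, α i) × (∀ i, α i) => P q.1 * P (splice {a, b} q.1 q.2))
      =ᵐ[(Measure.pi lam).prod (Measure.pi lam)]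
      fun q => P (splice {a} q.1 q.2) * P (splice {b} q.1 q.2) := by
    filter_upwards [hae] with ⟨x, y⟩ hxy
    simp only at hxy ⊢
    have h5 : ENNReal.ofReal (P x) * ENNReal.ofReal (P (splice {a, b} x y)) *
        ((∏ i, wt i (x i)) * ∏ i, wt i (splice {a, b} x y i)) =
        ENNReal.ofReal (P (splice {a} x y)) * ENNReal.ofReal (P (splice {b} x y)) *
        ((∏ i, wt i (x i)) * ∏ i, wt i (splice {a, b} x y i)) := by
      calc _ = _ := by ring
        _ = _ := hxy
        _ = ENNReal.ofReal (P (splice {a} x y)) * ENNReal.ofReal (P (splice {b} x y)) *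
          ((∏ i, wt i (splice {a} x y i)) * ∏ i, wt i (splice {b} x y i)) := by ring
        _ = _ := by rw [hW]
    have h6 := (ENNReal.mul_left_inj (mul_ne_zero (hW0 _) (hW0 _))
      (ENNReal.mul_ne_top (hWt _) (hWt _))).1 h5
    rw [← ENNReal.ofReal_mul (hP0 _).le, ← ENNReal.ofReal_mul (hP0 _).le,
      ENNReal.ofReal_eq_ofReal_iff (by have := hP0 x; have := hP0 (splice {a, b} x y); positivity)
        (mul_nonneg (hP0 _).le (hP0 _).le)] at h6
    exact h6
  -- The reference measure charges every nonempty open set, so continuous functions that agree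
  -- almost everywhere agree everywhere.
  have := (Continuous.ae_eq_iff_eq _
    ((hP.comp continuous_fst).mul (hP.comp (continuous_splice _)))
    ((hP.comp (continuous_splice _)).mul (hP.comp (continuous_splice _)))).1 hae'
  exact congrFun this (x, y)

end CondIndep

/-! ### Reference measures -/

instance instTopologicalSpaceVal (C : ℕ) {n : ℕ} : (v : Node n) → TopologicalSpace (Val C v)
  | some _ => inferInstanceAs (TopologicalSpace ℝ)
  | none => inferInstanceAs (TopologicalSpace (Fin C))

/-- The Lebesgue measure for the latent variables, the counting measure for the label. -/
def refMeasure (C : ℕ) {n : ℕ} : (v : Node n) → Measure (Val C v)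
  | some _ => (volume : Measure ℝ)
  | none => (Measure.count : Measure (Fin C))

/-- A probability measure equivalent to `refMeasure`. -/
def refProb (C : ℕ) {n : ℕ} : (v : Node n) → Measure (Val C v)
  | some _ => gaussianReal 0 1
  | none => (C : ENNReal)⁻¹ • (Measure.count : Measure (Fin C))

/-- The density of `refMeasure` with respect to `refProb`. -/
def refWeight (C : ℕ) {n : ℕ} : (v : Node n) → Val C v → ENNReal
  | some _ => fun x : ℝ => (gaussianPDF 0 1 x)⁻¹
  | none => fun _ => (C : ENNReal)

lemma measurable_refWeight (C : ℕ) {n : ℕ} : ∀ v : Node n, Measurable (refWeight C v)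
  | some _ => (measurable_gaussianPDF 0 1).inv
  | none => measurable_const

lemma refWeight_ne_zero (C : ℕ) [NeZero C] {n : ℕ} : ∀ (v : Node n) x, refWeight C v x ≠ 0
  | some _, x => ENNReal.inv_ne_zero.2 (gaussianPDF_lt_top (x := x)).ne
  | none, _ => by simpa [refWeight] using NeZero.ne C

lemma refWeight_ne_top (C : ℕ) {n : ℕ} : ∀ (v : Node n) x, refWeight C v x ≠ ⊤
  | some _, x => ENNReal.inv_ne_top.2 (gaussianPDF_pos 0 one_ne_zero x).ne'
  | none, _ => ENNReal.natCast_ne_top C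

instance instIsProbabilityMeasureRefProb (C : ℕ) [NeZero C] {n : ℕ} :
    ∀ v : Node n, IsProbabilityMeasure (refProb C v)
  | some _ => inferInstanceAs (IsProbabilityMeasure (gaussianReal 0 1))
  | none => ⟨by
      change ((C : ENNReal)⁻¹ • (Measure.count : Measure (Fin C))) Set.univ = 1
      rw [Measure.smul_apply, Measure.count_apply MeasurableSet.univ]
      simp only [Set.encard_univ, ENat.card_eq_coe_fintype_card, Fintype.card_fin, smul_eq_mul]
      exact ENNReal.inv_mul_cancel (by simpa using NeZero.ne C) (ENNReal.natCast_ne_top C)⟩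

instance instSigmaFiniteRefMeasure (C : ℕ) {n : ℕ} : ∀ v : Node n, SigmaFinite (refMeasure C v)
  | some _ => inferInstanceAs (SigmaFinite (volume : Measure ℝ))
  | none => inferInstanceAs (SigmaFinite (Measure.count : Measure (Fin C)))

instance instIsOpenPosMeasureRefProb (C : ℕ) {n : ℕ} :
    ∀ v : Node n, (refProb C v).IsOpenPosMeasure
  | some _ => (gaussianReal_absolutelyContinuous' 0 one_ne_zero).isOpenPosMeasure
  | none => by
      have hc : (Measure.count : Measure (Fin C)).IsOpenPosMeasure :=
        ⟨fun _ _ hne => Measure.count_ne_zero hne⟩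
      have h : ((C : ENNReal)⁻¹ • (Measure.count : Measure (Fin C))).IsOpenPosMeasure :=
        (Measure.absolutelyContinuous_smul
          (ENNReal.inv_ne_zero.2 (ENNReal.natCast_ne_top C))).isOpenPosMeasure
      exact h

/-- Averages over coordinates need probability measures, which Lebesgue and counting measure are not
in general. The product weight moved into the density cancels in the cross identity. -/
lemma refMeasure_eq (C : ℕ) [NeZero C] {n : ℕ} :
    ∀ v : Node n, refMeasure C v = (refProb C v).withDensity (refWeight C v)
  | some _ => by
      change (volume : Measure ℝ) =
        (gaussianReal 0 1).withDensity (fun x => (gaussianPDF 0 1 x)⁻¹)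
      rw [gaussianReal_of_var_ne_zero 0 one_ne_zero, withDensity_inv_same
        (measurable_gaussianPDF 0 1)
        (Filter.Eventually.of_forall fun x => (gaussianPDF_pos 0 one_ne_zero x).ne')
        (Filter.Eventually.of_forall fun x => (gaussianPDF_lt_top (x := x)).ne)]
  | none => by
      change (Measure.count : Measure (Fin C)) =
        ((C : ENNReal)⁻¹ • (Measure.count : Measure (Fin C))).withDensity (fun _ => (C : ENNReal))
      rw [withDensity_const, smul_smul,
        ENNReal.mul_inv_cancel (by simpa using NeZero.ne C) (ENNReal.natCast_ne_top C), one_smul]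

lemma pi_withDensity_prod {ι : Type*} {α : ι → Type*} [∀ i, MeasurableSpace (α i)] [Fintype ι]
    (lam : ∀ i, Measure (α i)) [∀ i, IsProbabilityMeasure (lam i)] {wt : ∀ i, α i → ENNReal}
    (hw : ∀ i, Measurable (wt i)) [∀ i, SigmaFinite ((lam i).withDensity (wt i))] :
    Measure.pi (fun i => (lam i).withDensity (wt i)) =
      (Measure.pi lam).withDensity fun x => ∏ i, wt i (x i) := by
  refine Measure.pi_eq fun s hs => ?_
  have hms : MeasurableSet (Set.univ.pi s) := MeasurableSet.univ_pi hs
  have hind : iIndepFun (fun i (x : ∀ i, α i) => (s i).indicator (wt i) (x i)) (Measure.pi lam) :=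
    iIndepFun_pi fun i => ((hw i).indicator (hs i)).aemeasurable
  rw [withDensity_apply _ hms, ← lintegral_indicator hms]
  have h1 : (Set.univ.pi s).indicator (fun x => ∏ i, wt i (x i)) =
      fun x : ∀ i, α i => ∏ i, (s i).indicator (wt i) (x i) := by
    funext x
    by_cases hx : x ∈ Set.univ.pi s
    · rw [Set.indicator_of_mem hx]
      exact Finset.prod_congr rfl fun i _ =>
        (Set.indicator_of_mem (hx i (Set.mem_univ i)) _).symm
    · rw [Set.indicator_of_notMem hx]
      simp only [Set.mem_pi, Set.mem_univ, true_imp_iff, not_forall] at hx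
      obtain ⟨i, hi⟩ := hx
      exact (Finset.prod_eq_zero (Finset.mem_univ i) (Set.indicator_of_notMem hi _)).symm
  rw [h1, lintegral_prod_eq_prod_lintegral_of_indepFun _ _ hind fun i =>
    ((hw i).indicator (hs i)).comp (measurable_pi_apply i)]
  refine Finset.prod_congr rfl fun i _ => ?_
  rw [withDensity_apply _ (hs i), ← lintegral_indicator (hs i)]
  exact (measurePreserving_eval lam i).lintegral_comp ((hw i).indicator (hs i))

lemma pi_refMeasure (n C : ℕ) [NeZero C] :
    Measure.pi (refMeasure C (n := n)) =
      (Measure.pi (refProb C (n := n))).withDensity fun x => ∏ v, refWeight C v (x v) := by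
  have : ∀ v : Node n, SigmaFinite ((refProb C v).withDensity (refWeight C v)) := fun v => by
    rw [← refMeasure_eq]; infer_instance
  rw [← pi_withDensity_prod (refProb C (n := n)) (measurable_refWeight C)]
  congr 1
  funext v
  exact refMeasure_eq C v

/-- A joint value of all the variables, as a pair of the latent part and the label. -/
def splitEquiv (n C : ℕ) : Assignment n C ≃ᵐ (Fin n → ℝ) × Fin C :=
  MeasurableEquiv.piOptionEquivProd (fun v : Node n => Val C v)

lemma map_splitEquiv_symm (n C : ℕ) :
    ((volume : Measure (Fin n → ℝ)).prod (Measure.count : Measure (Fin C))).map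
      (splitEquiv n C).symm = Measure.pi (refMeasure C (n := n)) :=
  Measure.pi_map_piOptionEquivProd (refMeasure C (n := n))

/-- The joint value with latent part `z` and label `c`. -/
def assign {n C : ℕ} (z : Fin n → ℝ) (c : Fin C) : Assignment n C
  | some i => z i
  | none => c

lemma latent_assign {n C : ℕ} (z : Fin n → ℝ) (c : Fin C) : latent (assign z c) = z := rfl

lemma label_assign {n C : ℕ} (z : Fin n → ℝ) (c : Fin C) : label (assign z c) = c := rfl

lemma measurable_latent {n C : ℕ} : Measurable (latent (n := n) (C := C)) :=
  measurable_fst.comp (splitEquiv n C).measurable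

lemma measurable_label {n C : ℕ} : Measurable (label (n := n) (C := C)) :=
  measurable_snd.comp (splitEquiv n C).measurable

lemma continuous_latent {n C : ℕ} : Continuous (latent (n := n) (C := C)) :=
  continuous_pi fun i => continuous_apply (A := fun v : Node n => Val C v) (some i)

lemma continuous_label {n C : ℕ} : Continuous (label (n := n) (C := C)) :=
  continuous_apply (A := fun v : Node n => Val C v) none

/-! ### Densities of the laws of a model -/

namespace LatentModel

variable {U : Type w} {n d C : ℕ} (M : LatentModel U n d C)

lemma wellFounded_edge : WellFounded M.edge := by
  have : IsTrans (Node n) (Relation.TransGen M.edge) := ⟨fun _ _ _ => Relation.TransGen.trans⟩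
  have : Std.Irrefl (Relation.TransGen M.edge) := ⟨M.acyclic⟩
  exact Subrelation.wf (fun h => Relation.TransGen.single h)
    (Finite.wellFounded_of_trans_of_irrefl (Relation.TransGen M.edge))

/-- `sol` is only known to solve the structural equations; acyclicity determines it from the
mechanisms, recursively along the graph. -/
lemma measurable_sol (u : U) : Measurable (M.sol u) := by
  refine measurable_pi_lambda _ fun v => ?_
  induction v using M.wellFounded_edge.induction with
  | _ v ih =>
    simp only [M.structural_eq u _ v]
    exact (M.mech_measurable v u).comp
      ((measurable_pi_lambda _ fun p => ih p.1 p.2).prodMk (measurable_pi_apply v))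

instance instIsProbabilityMeasureLaw (u : U) : IsProbabilityMeasure (M.law u) :=
  Measure.isProbabilityMeasure_map (M.measurable_sol u).aemeasurable

lemma map_splitEquiv_law (u : U) : (M.law u).map (splitEquiv n C) =
    ((volume : Measure (Fin n → ℝ)).prod (Measure.count : Measure (Fin C))).withDensity
        fun q => ENNReal.ofReal (M.dens u q.1 q.2) := by
  rw [law, Measure.map_map (splitEquiv n C).measurable (M.measurable_sol u), ← M.dens_spec u]
  rfl

lemma continuous_dens (u : U) :
    Continuous fun x : Assignment n C => M.dens u (latent x) (label x) := by
  have h : Continuous fun q : Fin C × (Fin n → ℝ) => M.dens u q.2 q.1 :=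
    continuous_prod_of_discrete_left.2 fun c => (M.dens_diff u c).1.continuous
  exact h.comp (continuous_label.prodMk continuous_latent)

lemma measurable_dens (u : U) :
    Measurable fun q : (Fin n → ℝ) × Fin C => M.dens u q.1 q.2 :=
  measurable_from_prod_countable_left fun c => (M.dens_diff u c).1.continuous.measurable

lemma law_eq_withDensity [NeZero C] (u : U) :
    M.law u = (Measure.pi (refProb C (n := n))).withDensity fun x =>
      ENNReal.ofReal (M.dens u (latent x) (label x)) * ∏ v, refWeight C v (x v) := by
  have hd : Measurable fun x : Assignment n C =>
      ENNReal.ofReal (M.dens u (latent x) (label x)) :=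
    ((M.measurable_dens u).comp (measurable_latent.prodMk measurable_label)).ennreal_ofReal
  have hw : Measurable fun x : Assignment n C => ∏ v, refWeight C v (x v) :=
    Finset.measurable_prod _ fun v _ => (measurable_refWeight C v).comp (measurable_pi_apply v)
  have h1 : M.law u = ((M.law u).map (splitEquiv n C)).map (splitEquiv n C).symm := by
    rw [Measure.map_map (splitEquiv n C).symm.measurable (splitEquiv n C).measurable]
    simp
  have h2 : M.law u = (Measure.pi (refMeasure C (n := n))).withDensity fun x =>
      ENNReal.ofReal (M.dens u (latent x) (label x)) := by
    rw [h1, map_splitEquiv_law, ← map_splitEquiv_symm]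
    ext s hs
    rw [MeasurableEquiv.map_apply, withDensity_apply _ ((splitEquiv n C).symm.measurable hs),
      withDensity_apply _ hs, setLIntegral_map hs hd (splitEquiv n C).symm.measurable]
    rfl
  rw [h2, pi_refMeasure, ← withDensity_mul _ hw hd]
  congr 1
  funext x
  exact mul_comm _ _

end LatentModel

/-! ### Cross identities and vanishing derivatives of the log-density -/

namespace LatentModel

variable {U : Type w} {n d C : ℕ} (M : LatentModel U n d C)

lemma condIndepFun_congr_measure {Ω β γ : Type*} {m : MeasurableSpace Ω} [mΩ : MeasurableSpace Ω]
    [StandardBorelSpace Ω] [MeasurableSpace β] [MeasurableSpace γ] (hm : m ≤ mΩ) {f : Ω → β}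
    {g : Ω → γ} {μ ν : Measure Ω} [IsFiniteMeasure μ] [IsFiniteMeasure ν] (h : μ = ν) :
    CondIndepFun m hm f g μ ↔ CondIndepFun m hm f g ν := by
  subst h
  rfl

lemma dens_cross_identity [NeZero C] {u : U} {a b : Node n} (hab : a ≠ b)
    (h : M.CondIndepVars u a b {a, b}ᶜ) (x y : Assignment n C) :
    M.dens u (latent x) (label x) *
        M.dens u (latent (splice {a, b} x y)) (label (splice {a, b} x y)) =
      M.dens u (latent (splice {a} x y)) (label (splice {a} x y)) *
        M.dens u (latent (splice {b} x y)) (label (splice {b} x y)) := by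
  have hlaw := M.law_eq_withDensity u
  have hfin : IsFiniteMeasure ((Measure.pi (refProb C (n := n))).withDensity fun x =>
      ENNReal.ofReal (M.dens u (latent x) (label x)) * ∏ v, refWeight C v (x v)) := by
    rw [← hlaw]; infer_instance
  exact cross_identity_of_condIndep (refProb C (n := n)) hab (M.continuous_dens u)
    ((M.measurable_dens u).comp (measurable_latent.prodMk measurable_label))
    (fun x => M.dens_pos u _ _) (measurable_refWeight C) (refWeight_ne_zero C)
    (refWeight_ne_top C) ((condIndepFun_congr_measure _ hlaw).1 h) x y

lemma log_cross_identity [NeZero C] {u : U} {a b : Node n} (hab : a ≠ b)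
    (h : M.CondIndepVars u a b {a, b}ᶜ) (x y : Assignment n C) :
    M.logDens u (label x) (latent x) +
        M.logDens u (label (splice {a, b} x y)) (latent (splice {a, b} x y)) =
      M.logDens u (label (splice {a} x y)) (latent (splice {a} x y)) +
        M.logDens u (label (splice {b} x y)) (latent (splice {b} x y)) := by
  unfold logDens
  rw [← Real.log_mul (M.dens_pos u _ _).ne' (M.dens_pos u _ _).ne',
    ← Real.log_mul (M.dens_pos u _ _).ne' (M.dens_pos u _ _).ne', M.dens_cross_identity hab h]

lemma contDiff_logDens (u : U) (c : Fin C) : ContDiff ℝ 2 (M.logDens u c) :=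
  (M.dens_diff u c).1.log fun z => (M.dens_pos u z c).ne'

end LatentModel

lemma partialDeriv_eq_deriv {n : ℕ} {f : (Fin n → ℝ) → ℝ} {z : Fin n → ℝ}
    (hf : DifferentiableAt ℝ f z) (i : Fin n) :
    partialDeriv i f z = deriv (fun t : ℝ => f (z + t • Pi.single i 1)) 0 :=
  hf.lineDeriv_eq_fderiv.symm

/-- The hypothesis says that a step along `i` changes the restriction of `f` to lines along `j` only
by a constant, so the `j`-derivative is constant along `i`. -/
lemma partialDeriv_partialDeriv_eq_zero {n : ℕ} {f : (Fin n → ℝ) → ℝ} (hf : Differentiable ℝ f)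
    {i j : Fin n}
    (h : ∀ z (s t : ℝ), f z + f (z + s • Pi.single i 1 + t • Pi.single j 1) =
      f (z + s • Pi.single i 1) + f (z + t • Pi.single j 1)) (z : Fin n → ℝ) :
    partialDeriv i (partialDeriv j f) z = 0 := by
  have hc : ∀ s : ℝ, partialDeriv j f (z + s • Pi.single i 1) = partialDeriv j f z := by
    intro s
    rw [partialDeriv_eq_deriv (hf _), partialDeriv_eq_deriv (hf _)]
    have : (fun t : ℝ => f (z + s • Pi.single i 1 + t • Pi.single j 1)) =
        fun t => f (z + t • Pi.single j 1) + (f (z + s • Pi.single i 1) - f z) := by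
      funext t
      linarith [h z s t]
    rw [this, deriv_add_const]
  by_cases hd : DifferentiableAt ℝ (partialDeriv j f) z
  · rw [partialDeriv_eq_deriv hd]
    simp only [hc, deriv_const]
  -- Without differentiability `fderiv` is zero by convention.
  · unfold partialDeriv at hd ⊢
    rw [fderiv_zero_of_not_differentiableAt hd]
    rfl

namespace LatentModel

variable {U : Type w} {n d C : ℕ} (M : LatentModel U n d C)

lemma partialDeriv_partialDeriv_logDens_eq_zero [NeZero C] {i j : Fin n} (hij : i ≠ j)
    (h : ¬ M.markovNetwork.Adj (some i) (some j)) (u : U) (c : Fin C) (z : Fin n → ℝ) :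
    partialDeriv i (partialDeriv j (M.logDens u c)) z = 0 := by
  have hsij : (some i : Node n) ≠ some j := fun h => hij (Option.some_injective _ h)
  have hci : M.CondIndepVars u (some i) (some j) {some i, some j}ᶜ := by
    by_contra hc
    exact h ⟨hsij, u, hc⟩
  refine partialDeriv_partialDeriv_eq_zero
    ((M.contDiff_logDens u c).differentiable (by norm_num)) (fun z s t => ?_) z
  have key := M.log_cross_identity hsij hci (assign z c)
    (assign (z + s • Pi.single i 1 + t • Pi.single j 1) c)
  have e1 : splice {some i, some j} (assign z c)
      (assign (z + s • Pi.single i 1 + t • Pi.single j 1) c) =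
      assign (z + s • Pi.single i 1 + t • Pi.single j 1) c := by
    funext v
    by_cases hv : v ∈ ({some i, some j} : Set (Node n))
    · rw [splice_of_mem _ _ hv]
    · rw [splice_of_notMem _ _ hv]
      cases v with
      | none => rfl
      | some k =>
        have hk : k ≠ i ∧ k ≠ j := by
          refine ⟨fun h => hv ?_, fun h => hv ?_⟩ <;> simp [h]
        change z k = _
        simp [assign, hk.1, hk.2]
  have e2 : splice {some i} (assign z c)
      (assign (z + s • Pi.single i 1 + t • Pi.single j 1) c) =
      assign (z + s • Pi.single i 1) c := by
    funext v
    by_cases hv : v ∈ ({some i} : Set (Node n))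
    · rw [splice_of_mem _ _ hv]
      obtain rfl : v = some i := hv
      change (z + s • Pi.single i 1 + t • Pi.single j 1 : Fin n → ℝ) i =
        (z + s • Pi.single i 1 : Fin n → ℝ) i
      simp [hij]
    · rw [splice_of_notMem _ _ hv]
      cases v with
      | none => rfl
      | some k =>
        have hk : k ≠ i := fun h => hv (by simp [h])
        change z k = (z + s • Pi.single i 1 : Fin n → ℝ) k
        simp [hk]
  have e3 : splice {some j} (assign z c)
      (assign (z + s • Pi.single i 1 + t • Pi.single j 1) c) =
      assign (z + t • Pi.single j 1) c := by
    funext v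
    by_cases hv : v ∈ ({some j} : Set (Node n))
    · rw [splice_of_mem _ _ hv]
      obtain rfl : v = some j := hv
      change (z + s • Pi.single i 1 + t • Pi.single j 1 : Fin n → ℝ) j =
        (z + t • Pi.single j 1 : Fin n → ℝ) j
      simp [hij.symm]
    · rw [splice_of_notMem _ _ hv]
      cases v with
      | none => rfl
      | some k =>
        have hk : k ≠ j := fun h => hv (by simp [h])
        change z k = (z + t • Pi.single j 1 : Fin n → ℝ) k
        simp [hk]
  rw [e1, e2, e3] at key
  exact key

/-- The cross identity between `(z, c)` and `(z + t eᵢ, c')` shows that the difference of the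
log-densities of two labels is constant along `i`. -/
lemma partialDeriv_logDens_eq [NeZero C] {i : Fin n}
    (h : ¬ M.markovNetwork.Adj (some i) none) (u : U) (c c' : Fin C) (z : Fin n → ℝ) :
    partialDeriv i (M.logDens u c) z = partialDeriv i (M.logDens u c') z := by
  have hne : (some i : Node n) ≠ none := Option.some_ne_none i
  have hci : M.CondIndepVars u (some i) none {some i, none}ᶜ := by
    by_contra hc
    exact h ⟨hne, u, hc⟩
  have hd := fun c => (M.contDiff_logDens u c).differentiable (by norm_num)
  rw [partialDeriv_eq_deriv (hd c z), partialDeriv_eq_deriv (hd c' z)]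
  have : (fun t : ℝ => M.logDens u c (z + t • Pi.single i 1)) =
      fun t => M.logDens u c' (z + t • Pi.single i 1) + (M.logDens u c z - M.logDens u c' z) := by
    funext t
    have key := M.log_cross_identity hne hci (assign z c) (assign (z + t • Pi.single i 1) c')
    have e1 : splice {some i, none} (assign z c) (assign (z + t • Pi.single i 1) c') =
        assign (z + t • Pi.single i 1) c' := by
      funext v
      by_cases hv : v ∈ ({some i, none} : Set (Node n))
      · rw [splice_of_mem _ _ hv]
      · rw [splice_of_notMem _ _ hv]
        cases v with
        | none => simp at hv
        | some k =>
          have hk : k ≠ i := fun h => hv (by simp [h])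
          change z k = (z + t • Pi.single i 1 : Fin n → ℝ) k
          simp [hk]
    have e2 : splice {some i} (assign z c) (assign (z + t • Pi.single i 1) c') =
        assign (z + t • Pi.single i 1) c := by
      funext v
      by_cases hv : v ∈ ({some i} : Set (Node n))
      · rw [splice_of_mem _ _ hv]
        obtain rfl : v = some i := hv
        rfl
      · rw [splice_of_notMem _ _ hv]
        cases v with
        | none => rfl
        | some k =>
          have hk : k ≠ i := fun h => hv (by simp [h])
          change z k = (z + t • Pi.single i 1 : Fin n → ℝ) k
          simp [hk]
    have e3 : splice {none} (assign z c) (assign (z + t • Pi.single i 1) c') = assign z c' := by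
      funext v
      cases v with
      | none => exact splice_of_mem _ _ rfl
      | some k => exact splice_of_notMem _ _ (Option.some_ne_none k)
    rw [e1, e2, e3] at key
    simp only [latent_assign, label_assign] at key
    linarith
  rw [this, deriv_add_const]

end LatentModel

namespace LatentModel

variable {U : Type w} {n d C : ℕ} (M : LatentModel U n d C)

/-! ### The Markov blanket -/

lemma mem_parents {i : Fin n} : i ∈ M.parents ↔ M.edge (some i) none := by
  simp [parents]

lemma mem_children {i : Fin n} : i ∈ M.children ↔ M.edge none (some i) := by
  simp [children]

lemma mem_spouses {i : Fin n} : i ∈ M.spouses ↔ i ∉ M.parents ∧ i ∉ M.children ∧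
    ∃ j ∈ M.children, M.edge (some i) (some j) := by
  classical
  unfold spouses
  rw [Finset.mem_filter_univ]

lemma mem_blanket {i : Fin n} : i ∈ M.blanket ↔ M.edge (some i) none ∨ M.edge none (some i) ∨
    ∃ j, M.edge none (some j) ∧ M.edge (some i) (some j) := by
  simp only [blanket, Finset.mem_union, mem_parents, mem_children, mem_spouses]
  tauto

/-! ### Factorization of the law along the graph -/

/-- A set of nodes which contains the parents of its elements. -/
def IsAncestral (A : Set (Node n)) : Prop := ∀ v ∈ A, ∀ p, M.edge p v → p ∈ A

lemma not_edge_self (v : Node n) : ¬ M.edge v v := fun h => M.acyclic v (Relation.TransGen.single h)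

lemma sol_congr {A : Set (Node n)} (hA : M.IsAncestral A) (u : U) {ε ε' : Node n → ℝ}
    (h : ∀ v ∈ A, ε v = ε' v) (v : Node n) (hv : v ∈ A) : M.sol u ε v = M.sol u ε' v := by
  induction v using M.wellFounded_edge.induction with
  | _ v ih =>
    rw [M.structural_eq u ε v, M.structural_eq u ε' v, h v hv]
    congr 1
    funext p
    exact ih p.1 p.2 (hA v hv p.1 p.2)

/-- The values of the parents of `v`. -/
def parentVals (v : Node n) (x : Assignment n C) : ∀ p : {p // M.edge p v}, Val C p.1 :=
  fun p => x p.1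

lemma measurable_parentVals (v : Node n) : Measurable (M.parentVals v) :=
  measurable_pi_lambda _ fun p => measurable_pi_apply p.1

/-- The conditional law of `v` given its parents in the domain `u`. -/
def mechKernel (u : U) (v : Node n) : Kernel (∀ p : {p // M.edge p v}, Val C p.1) (Val C v) :=
  (Kernel.id ×ₖ Kernel.const _ (M.noise v)).map fun q => M.mech v q.1 q.2 (M.param v u)

instance (u : U) (v : Node n) : IsMarkovKernel (M.mechKernel u v) :=
  Kernel.IsMarkovKernel.map _ (M.mech_measurable v u)

lemma lintegral_mechKernel (u : U) (v : Node n) (r : ∀ p : {p // M.edge p v}, Val C p.1)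
    {F : Val C v → ENNReal} (hF : Measurable F) :
    ∫⁻ y, F y ∂M.mechKernel u v r = ∫⁻ e, F (M.mech v r e (M.param v u)) ∂M.noise v := by
  have hm := M.mech_measurable v u
  have hm' : Measurable fun q : (∀ p : {p // M.edge p v}, Val C p.1) × ℝ =>
      F (M.mech v q.1 q.2 (M.param v u)) := hF.comp hm
  rw [mechKernel, Kernel.lintegral_map _ hm _ hF, Kernel.prod_apply, Kernel.id_apply,
    Kernel.const_apply, lintegral_prod _ hm'.aemeasurable]
  exact lintegral_dirac' _ hm'.lintegral_prod_right'

/-- The conditional density of `v` given its parents, with respect to `refProb`. -/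
def mechDens (u : U) (v : Node n) (x : Assignment n C) : ENNReal :=
  (M.mechKernel u v).rnDeriv (Kernel.const _ (refProb C v)) (M.parentVals v x) (x v)

lemma dependsOn_mechDens (u : U) (v : Node n) :
    DependsOn (M.mechDens u v) {p | p = v ∨ M.edge p v} := by
  intro x y h
  have h1 : M.parentVals v x = M.parentVals v y := funext fun p => h p.1 (Or.inr p.2)
  rw [mechDens, mechDens, h1, h v (Or.inl rfl)]

variable [NeZero C]

lemma measurable_mechDens (u : U) (v : Node n) : Measurable (M.mechDens u v) :=
  (Kernel.measurable_rnDeriv (M.mechKernel u v) (Kernel.const _ (refProb C v))).comp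
    ((M.measurable_parentVals v).prodMk (measurable_pi_apply v))

/-- The law of the variables in `A`, completed with independent reference variables. -/
def partialLaw (u : U) (A : Set (Node n)) : Measure (Assignment n C) :=
  ((M.law u).prod (Measure.pi (refProb C (n := n)))).map fun q => splice Aᶜ q.1 q.2

lemma lintegral_partialLaw (u : U) (A : Set (Node n)) {F : Assignment n C → ENNReal}
    (hF : Measurable F) : ∫⁻ x, F x ∂M.partialLaw u A =
      ∫⁻ ε, ∫⁻ y, F (splice Aᶜ (M.sol u ε) y) ∂Measure.pi (refProb C (n := n))
        ∂Measure.pi M.noise := by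
  have hm : Measurable fun q : Assignment n C × Assignment n C => F (splice Aᶜ q.1 q.2) :=
    hF.comp (measurable_splice _)
  rw [partialLaw, lintegral_map hF (measurable_splice _), lintegral_prod _ hm.aemeasurable, law,
    lintegral_map hm.lintegral_prod_right' (M.measurable_sol u)]

/-- Splicing preserves the reference product measure, so the absolute continuity of the full law
survives it. -/
lemma partialLaw_absolutelyContinuous (u : U) (A : Set (Node n)) :
    M.partialLaw u A ≪ Measure.pi (refProb C (n := n)) := by
  have h : M.law u ≪ Measure.pi (refProb C (n := n)) := by
    rw [M.law_eq_withDensity u]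
    exact withDensity_absolutelyContinuous _ _
  have h2 := (h.prod (Measure.AbsolutelyContinuous.refl (Measure.pi (refProb C (n := n))))).map
    (measurable_splice (α := fun v : Node n => Val C v) Aᶜ)
  rwa [map_splice] at h2

/-- The point `x` with the coordinate `v` replaced. -/
def setCoord (v : Node n) (x : Assignment n C) (y : Val C v) : Assignment n C :=
  Function.update x v y

lemma measurable_setCoord (v : Node n) :
    Measurable fun q : Assignment n C × Val C v => setCoord v q.1 q.2 := by
  refine measurable_pi_lambda _ fun i => ?_
  by_cases h : i = v
  · subst h
    simp only [setCoord, Function.update_self]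
    exact measurable_snd
  · simp only [setCoord, Function.update_of_ne h]
    exact (measurable_pi_apply i).comp measurable_fst

lemma parentVals_setCoord (v : Node n) (x : Assignment n C) (y : Val C v) :
    M.parentVals v (setCoord v x y) = M.parentVals v x := by
  funext p
  have : p.1 ≠ v := fun h => M.acyclic v (Relation.TransGen.single
    (Eq.subst (motive := fun w => M.edge w v) h p.2))
  exact Function.update_of_ne this _ _

lemma lintegral_eval_refProb (v : Node n) {F : Val C v → ENNReal} (hF : Measurable F) :
    ∫⁻ y, F (y v) ∂Measure.pi (refProb C (n := n)) = ∫⁻ y, F y ∂refProb C v :=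
  (measurePreserving_eval (refProb C (n := n)) v).lintegral_comp hF

lemma lintegral_pi_refProb (v : Node n) {F : Assignment n C → ENNReal} (hF : Measurable F) :
    ∫⁻ x, F x ∂Measure.pi (refProb C (n := n)) =
      ∫⁻ x, ∫⁻ y, F (setCoord v x y) ∂refProb C v ∂Measure.pi (refProb C (n := n)) := by
  rw [← lintegral_spliceAvg (refProb C (n := n)) {v} hF]
  refine lintegral_congr fun x => ?_
  rw [← lintegral_eval_refProb v (F := fun y => F (setCoord v x y))
    (hF.comp ((measurable_setCoord v).comp measurable_prodMk_left))]
  refine lintegral_congr fun y => congrArg F (funext fun i => ?_)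
  by_cases h : i = v
  · subst h
    rw [splice_of_mem _ _ (Set.mem_singleton i), setCoord, Function.update_self]
  · rw [splice_of_notMem _ _ (show i ∉ ({v} : Set (Node n)) from h), setCoord,
      Function.update_of_ne h]

lemma lintegral_partialLaw_of_notMem (u : U) {A : Set (Node n)} {v : Node n} (hv : v ∉ A)
    {F : Assignment n C → ENNReal} (hF : Measurable F) :
    ∫⁻ x, F x ∂M.partialLaw u A =
      ∫⁻ x, ∫⁻ y, F (setCoord v x y) ∂refProb C v ∂M.partialLaw u A := by
  have hm : Measurable fun x : Assignment n C => ∫⁻ y, F (setCoord v x y) ∂refProb C v :=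
    (hF.comp (measurable_setCoord v)).lintegral_prod_right'
  rw [M.lintegral_partialLaw u A hF, M.lintegral_partialLaw u A hm]
  refine lintegral_congr fun ε => ?_
  have hs : Measurable fun y => splice Aᶜ (M.sol u ε) y :=
    (measurable_splice (α := fun v : Node n => Val C v) Aᶜ).comp measurable_prodMk_left
  have hFs : Measurable fun y => F (splice Aᶜ (M.sol u ε) y) := hF.comp hs
  rw [lintegral_pi_refProb v hFs]
  refine lintegral_congr fun x => lintegral_congr fun y => congrArg F (funext fun i => ?_)
  by_cases h : i = v
  · subst h
    rw [splice_of_mem _ _ (show i ∈ Aᶜ from hv), setCoord, setCoord, Function.update_self,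
      Function.update_self]
  · rw [setCoord, setCoord, Function.update_of_ne h]
    by_cases hi : i ∈ Aᶜ
    · rw [splice_of_mem _ _ hi, splice_of_mem _ _ hi, Function.update_of_ne h]
    · rw [splice_of_notMem _ _ hi, splice_of_notMem _ _ hi]

/-- The variables in an ancestral set `A` are functions of their own noises. The noise of `v` is
independent of these, so given `A` the variable `v` follows its mechanism at the values of its
parents. -/
lemma lintegral_partialLaw_insert (u : U) {A : Set (Node n)} (hA : M.IsAncestral A) {v : Node n}
    (hv : v ∉ A) (hp : ∀ p, M.edge p v → p ∈ A) {F : Assignment n C → ENNReal}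
    (hF : Measurable F) :
    ∫⁻ x, F x ∂M.partialLaw u (insert v A) =
      ∫⁻ x, ∫⁻ y, F (setCoord v x y) ∂M.mechKernel u v (M.parentVals v x) ∂M.partialLaw u A := by
  have hm : Measurable fun x : Assignment n C =>
      ∫⁻ y, F (setCoord v x y) ∂M.mechKernel u v (M.parentVals v x) :=
    Measurable.lintegral_kernel_prod_right' (κ := (M.mechKernel u v).comap _
      (M.measurable_parentVals v)) (hF.comp (measurable_setCoord v))
  rw [M.lintegral_partialLaw u _ hF, M.lintegral_partialLaw u A hm]
  have hs : ∀ B : Set (Node n), Measurable fun q : (Node n → ℝ) × Assignment n C =>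
      splice Bᶜ (M.sol u q.1) q.2 := fun B =>
    (measurable_splice (α := fun v : Node n => Val C v) Bᶜ).comp
      (((M.measurable_sol u).comp measurable_fst).prodMk measurable_snd)
  have hm1 : Measurable fun ε => ∫⁻ y, F (splice (insert v A)ᶜ (M.sol u ε) y)
      ∂Measure.pi (refProb C (n := n)) := (hF.comp (hs _)).lintegral_prod_right'
  -- The noise of `v` is redrawn; the variables in `A` do not notice it (`hagree` below).
  rw [← lintegral_spliceAvg M.noise {v} hm1]
  refine lintegral_congr fun ε => ?_
  unfold spliceAvg
  have hsp : Measurable fun q : (Node n → ℝ) × Assignment n C => splice {v} ε q.1 :=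
    ((measurable_splice (α := fun _ : Node n => ℝ) {v}).comp measurable_prodMk_left).comp
      measurable_fst
  have hsw : Measurable (Function.uncurry fun (ε' : Node n → ℝ) (y : Assignment n C) =>
      F (splice (insert v A)ᶜ (M.sol u (splice {v} ε ε')) y)) :=
    (hF.comp (hs (insert v A))).comp (hsp.prodMk measurable_snd)
  beta_reduce
  rw [lintegral_lintegral_swap hsw.aemeasurable]
  refine lintegral_congr fun y => ?_
  have hFr : Measurable fun y' => F (setCoord v (splice Aᶜ (M.sol u ε) y) y') :=
    hF.comp ((measurable_setCoord v).comp measurable_prodMk_left)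
  rw [M.lintegral_mechKernel u v _ hFr]
  have hme : Measurable fun e => F (setCoord v (splice Aᶜ (M.sol u ε) y)
      (M.mech v (M.parentVals v (splice Aᶜ (M.sol u ε) y)) e (M.param v u))) :=
    hF.comp ((measurable_setCoord v).comp (measurable_const.prodMk
      ((M.mech_measurable v u).comp measurable_prodMk_left)))
  rw [← (measurePreserving_eval M.noise v).lintegral_comp hme]
  refine lintegral_congr fun ε' => congrArg F (funext fun i => ?_)
  have hagree : ∀ j ∈ A, M.sol u (splice {v} ε ε') j = M.sol u ε j :=
    M.sol_congr hA u fun j hj =>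
      splice_of_notMem _ _ (show j ∉ ({v} : Set (Node n)) from fun h => hv (h ▸ hj))
  by_cases h : i = v
  · subst h
    rw [splice_of_notMem _ _ (show i ∉ (insert i A)ᶜ from fun h => h (Set.mem_insert i A)), setCoord, Function.update_self,
      M.structural_eq u _ i, splice_of_mem _ _ (Set.mem_singleton i)]
    congr 1
    funext p
    rw [hagree p.1 (hp p.1 p.2), parentVals,
      splice_of_notMem _ _ (show p.1 ∉ Aᶜ from fun h => h (hp p.1 p.2))]
  · rw [setCoord, Function.update_of_ne h]
    by_cases hi : i ∈ A
    · rw [splice_of_notMem _ _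
        (show i ∉ (insert v A)ᶜ from fun h => h (Set.mem_insert_of_mem v hi)),
        splice_of_notMem _ _ (show i ∉ Aᶜ from fun h => h hi), hagree i hi]
    · rw [splice_of_mem _ _ (show i ∈ (insert v A)ᶜ from fun h' => h'.elim h hi),
        splice_of_mem _ _ (show i ∈ Aᶜ from hi)]

/-- Only the joint law is assumed to have a density, so densities of the mechanisms must be derived.
The set carrying their singular parts is null for the reference measure, hence for the law of
`insert v A`, which gives it the integrated singular mass of the mechanism of `v`. -/
lemma ae_mechKernel_absolutelyContinuous (u : U) {A : Set (Node n)} (hA : M.IsAncestral A)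
    {v : Node n} (hv : v ∉ A) (hp : ∀ p, M.edge p v → p ∈ A) :
    ∀ᵐ x ∂M.partialLaw u A, M.mechKernel u v (M.parentVals v x) ≪ refProb C v := by
  set κ := M.mechKernel u v
  set η : Kernel (∀ p : {p // M.edge p v}, Val C p.1) (Val C v) := Kernel.const _ (refProb C v)
  set N : Set (Assignment n C) :=
    (fun x => (M.parentVals v x, x v)) ⁻¹' κ.mutuallySingularSet η
  have hN : MeasurableSet N :=
    ((M.measurable_parentVals v).prodMk (measurable_pi_apply v))
      (Kernel.measurableSet_mutuallySingularSet κ η)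
  have hslice : ∀ x : Assignment n C, (fun y => N.indicator (1 : Assignment n C → ENNReal)
      (setCoord v x y)) = (κ.mutuallySingularSetSlice η (M.parentVals v x)).indicator 1 := by
    intro x
    funext y
    have : setCoord v x y ∈ N ↔ y ∈ κ.mutuallySingularSetSlice η (M.parentVals v x) := by
      change (M.parentVals v (setCoord v x y), setCoord v x y v) ∈ κ.mutuallySingularSet η ↔ _
      rw [parentVals_setCoord, setCoord, Function.update_self]
      rfl
    by_cases h : y ∈ κ.mutuallySingularSetSlice η (M.parentVals v x)
    · rw [Set.indicator_of_mem h, Set.indicator_of_mem (this.2 h)]; rfl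
    · rw [Set.indicator_of_notMem h, Set.indicator_of_notMem fun h' => h (this.1 h')]
  have hN1 : Measurable (N.indicator (1 : Assignment n C → ENNReal)) :=
    measurable_one.indicator hN
  have h0 : Measure.pi (refProb C (n := n)) N = 0 := by
    rw [← lintegral_indicator_one hN, lintegral_pi_refProb v hN1]
    refine (lintegral_congr fun x => ?_).trans lintegral_zero
    rw [hslice, lintegral_indicator_one (Kernel.measurableSet_mutuallySingularSetSlice κ η _)]
    exact Kernel.measure_mutuallySingularSetSlice κ η (M.parentVals v x)
  have h1 := M.partialLaw_absolutelyContinuous u (insert v A) h0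
  rw [← lintegral_indicator_one hN,
    M.lintegral_partialLaw_insert u hA hv hp hN1] at h1
  simp only [hslice] at h1
  have h2 : ∀ x, ∫⁻ y, (κ.mutuallySingularSetSlice η (M.parentVals v x)).indicator 1 y
      ∂κ (M.parentVals v x) =
      κ (M.parentVals v x) (κ.mutuallySingularSetSlice η (M.parentVals v x)) := fun x =>
    lintegral_indicator_one (Kernel.measurableSet_mutuallySingularSetSlice κ η _)
  have hm : Measurable fun x : Assignment n C =>
      κ (M.parentVals v x) (κ.mutuallySingularSetSlice η (M.parentVals v x)) :=
    (Kernel.measurable_kernel_prodMk_left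
      (Kernel.measurableSet_mutuallySingularSet κ η)).comp (M.measurable_parentVals v)
  have h1' : ∫⁻ x, κ (M.parentVals v x) (κ.mutuallySingularSetSlice η (M.parentVals v x))
      ∂M.partialLaw u A = 0 := by
    rw [← h1]
    exact lintegral_congr fun x => (h2 x).symm
  rw [lintegral_eq_zero_iff hm] at h1'
  filter_upwards [h1'] with x hx
  have := (Kernel.singularPart_eq_zero_iff_measure_eq_zero κ η (M.parentVals v x)).2 hx
  exact (Kernel.singularPart_eq_zero_iff_absolutelyContinuous κ η _).1 this

lemma partialLaw_insert (u : U) {A : Set (Node n)} (hA : M.IsAncestral A) {v : Node n}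
    (hv : v ∉ A) (hp : ∀ p, M.edge p v → p ∈ A) :
    M.partialLaw u (insert v A) = (M.partialLaw u A).withDensity (M.mechDens u v) := by
  have hq := M.measurable_mechDens u v
  refine Measure.ext_of_lintegral _ fun F hF => ?_
  rw [lintegral_withDensity_eq_lintegral_mul _ hq hF, M.lintegral_partialLaw_insert u hA hv hp hF,
    M.lintegral_partialLaw_of_notMem u hv (hq.mul hF)]
  refine lintegral_congr_ae ?_
  filter_upwards [M.ae_mechKernel_absolutelyContinuous u hA hv hp] with x hx
  have h1 := Kernel.withDensity_rnDeriv_eq (κ := M.mechKernel u v)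
    (η := Kernel.const _ (refProb C v)) (a := M.parentVals v x) hx
  have hFr : Measurable fun y => F (setCoord v x y) :=
    hF.comp ((measurable_setCoord v).comp measurable_prodMk_left)
  rw [← h1, Kernel.lintegral_withDensity _ (Kernel.measurable_rnDeriv _ _) _ hFr]
  refine lintegral_congr fun y => ?_
  simp only [Pi.mul_apply, mechDens, parentVals_setCoord]
  rw [show setCoord v x y v = y from Function.update_self ..]

lemma partialLaw_eq_withDensity (u : U) (A : Finset (Node n)) (hA : M.IsAncestral (A : Set (Node n))) :
    M.partialLaw u A = (Measure.pi (refProb C (n := n))).withDensity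
      fun x => ∏ v ∈ A, M.mechDens u v x := by
  classical
  induction A using Finset.strongInduction with
  | H A ih =>
    rcases A.eq_empty_or_nonempty with rfl | hne
    · simp only [Finset.prod_empty, Finset.coe_empty]
      have : (fun q : Assignment n C × Assignment n C =>
          splice (∅ : Set (Node n))ᶜ q.1 q.2) = Prod.snd := by
        funext q i
        exact splice_of_mem _ _ (fun h => h)
      rw [partialLaw, this, Measure.map_snd_prod, measure_univ, one_smul]
      exact (withDensity_one).symm
    -- A minimal element for the reversed order has no descendant in `A`, so removing it leaves an
    -- ancestral set that contains its parents.
    · have hwf : WellFounded (Function.swap (Relation.TransGen M.edge)) := by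
        have : IsTrans (Node n) (Function.swap (Relation.TransGen M.edge)) :=
          ⟨fun _ _ _ h h' => Relation.TransGen.trans h' h⟩
        have : Std.Irrefl (Function.swap (Relation.TransGen M.edge)) := ⟨M.acyclic⟩
        exact Finite.wellFounded_of_trans_of_irrefl _
      obtain ⟨v, hvA, hmax⟩ := hwf.has_min (A : Set (Node n)) hne
      have hanc : M.IsAncestral ((A.erase v : Finset (Node n)) : Set (Node n)) := by
        intro x hx p hpx
        rw [Finset.mem_coe, Finset.mem_erase] at hx ⊢
        refine ⟨?_, hA x hx.2 p hpx⟩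
        rintro rfl
        exact hmax x hx.2 (Relation.TransGen.single hpx)
      have hpa : ∀ p, M.edge p v → p ∈ ((A.erase v : Finset (Node n)) : Set (Node n)) := by
        intro p hp
        rw [Finset.mem_coe, Finset.mem_erase]
        exact ⟨fun h => M.not_edge_self v (h ▸ hp), hA v hvA p hp⟩
      have hA' : (A : Set (Node n)) = insert v ((A.erase v : Finset (Node n)) : Set (Node n)) := by
        rw [← Finset.coe_insert, Finset.insert_erase hvA]
      have hm : Measurable fun x : Assignment n C => ∏ w ∈ A.erase v, M.mechDens u w x :=
        Finset.measurable_prod _ fun w _ => M.measurable_mechDens u w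
      rw [hA', M.partialLaw_insert u hanc (by simp) hpa, ih _ (Finset.erase_ssubset hvA) hanc,
        ← withDensity_mul _ hm (M.measurable_mechDens u v)]
      congr 1
      funext x
      exact Finset.prod_erase_mul A _ hvA

lemma law_eq_withDensity_mechDens (u : U) :
    M.law u = (Measure.pi (refProb C (n := n))).withDensity
      fun x => ∏ v, M.mechDens u v x := by
  rw [← M.partialLaw_eq_withDensity u Finset.univ fun _ _ p _ => by simp]
  have : (fun q : Assignment n C × Assignment n C =>
      splice ((Finset.univ : Finset (Node n)) : Set (Node n))ᶜ q.1 q.2) = Prod.fst := by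
    funext q i
    exact splice_of_notMem _ _ (fun h => h (by simp))
  rw [partialLaw, this, Measure.map_fst_prod, measure_univ, one_smul]

/-! ### The Markov blanket is the neighborhood of the label -/

/-- The factors that involve the label are its own mechanism and those of its children. Their other
arguments all lie in the blanket, so these factors ignore `i`, and the remaining ones ignore the
label. -/
lemma not_adj_of_notMem_blanket {i : Fin n} (hi : i ∉ M.blanket) :
    ¬ M.markovNetwork.Adj none (some i) := by
  classical
  rintro ⟨hne, u, hu⟩
  apply hu
  rw [mem_blanket] at hi
  push Not at hi
  obtain ⟨h1, h2, h3⟩ := hi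
  set g : Assignment n C → ENNReal := fun x =>
    ∏ v ∈ Finset.univ.filter (fun v => v = none ∨ M.edge none v), M.mechDens u v x with hgdef
  set h : Assignment n C → ENNReal := fun x =>
    ∏ v ∈ Finset.univ.filter (fun v => ¬ (v = none ∨ M.edge none v)), M.mechDens u v x with hhdef
  have hg : Measurable g := Finset.measurable_prod _ fun v _ => M.measurable_mechDens u v
  have hh : Measurable h := Finset.measurable_prod _ fun v _ => M.measurable_mechDens u v
  have hgi : DependsOn g {some i}ᶜ := by
    intro x y hxy
    refine Finset.prod_congr rfl fun v hv => M.dependsOn_mechDens u v fun p hp => hxy p ?_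
    rw [Finset.mem_filter_univ] at hv
    rintro rfl
    rcases hv with rfl | hv
    · rcases hp with hp | hp
      · exact Option.some_ne_none i hp
      · exact h1 hp
    · rcases hp with rfl | hp
      · exact h2 hv
      · cases v with
        | none => exact h1 hp
        | some j => exact h3 j hv hp
  have hhY : DependsOn h {none}ᶜ := by
    intro x y hxy
    refine Finset.prod_congr rfl fun v hv => M.dependsOn_mechDens u v fun p hp => hxy p ?_
    rw [Finset.mem_filter_univ] at hv
    rintro rfl
    exact hv (hp.imp Eq.symm id)
  have hlaw : M.law u = (Measure.pi (refProb C (n := n))).withDensity fun x => g x * h x := by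
    rw [M.law_eq_withDensity_mechDens u]
    congr 1
    funext x
    exact (Finset.prod_filter_mul_prod_filter_not _ _ _).symm
  have hfin : IsFiniteMeasure
      ((Measure.pi (refProb C (n := n))).withDensity fun x => g x * h x) := by
    rw [← hlaw]; infer_instance
  exact (condIndepFun_congr_measure _ hlaw).2
    (condIndep_of_factorization (refProb C (n := n)) hne hg hh hgi hhY)

/-- Given all other variables, two kinds of path stay active: a single edge, and the path through a
common child, which is a conditioned collider. Faithfulness then excludes conditional independence.
-/
lemma adj_of_mem_blanket [Nonempty U] (hF : M.Faithful) {i : Fin n} (hi : i ∈ M.blanket) :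
    M.markovNetwork.Adj none (some i) := by
  obtain ⟨u⟩ := ‹Nonempty U›
  have hne : (none : Node n) ≠ some i := (Option.some_ne_none i).symm
  refine ⟨hne, u, fun hc => ?_⟩
  have hsep := hF u none (some i) {none, some i}ᶜ hne (fun h => h (Or.inl rfl))
    (fun h => h (Or.inr rfl)) hc
  rw [mem_blanket] at hi
  by_cases hadj : M.edge none (some i) ∨ M.edge (some i) none
  · have ha : (skeleton M.edge).Adj none (some i) := ⟨hne, hadj⟩
    refine hsep (SimpleGraph.Walk.cons ha SimpleGraph.Walk.nil) ⟨?_, ?_⟩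
    · simp
    · intro x m y hinf
      have := hinf.length_le
      simp at this
  · push Not at hadj
    obtain hi | hi | ⟨j, hj, hij⟩ := hi
    · exact absurd hi hadj.2
    · exact absurd hi hadj.1
    have hjn : (none : Node n) ≠ some j := (Option.some_ne_none j).symm
    have hji : (some j : Node n) ≠ some i := fun h => hadj.1 (h ▸ hj)
    have ha : (skeleton M.edge).Adj none (some j) := ⟨hjn, Or.inl hj⟩
    have hb : (skeleton M.edge).Adj (some j) (some i) := ⟨hji, Or.inr hij⟩
    refine hsep (SimpleGraph.Walk.cons ha (SimpleGraph.Walk.cons hb SimpleGraph.Walk.nil))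
      ⟨?_, ?_⟩
    · simp only [SimpleGraph.Walk.cons_isPath_iff, SimpleGraph.Walk.support_cons,
        SimpleGraph.Walk.support_nil, List.mem_cons, List.not_mem_nil, or_false]
      exact ⟨⟨SimpleGraph.Walk.IsPath.nil, hji⟩, by simp⟩
    · intro x m y hinf
      have heq := hinf.eq_of_length (by simp)
      simp only [SimpleGraph.Walk.support_cons, SimpleGraph.Walk.support_nil, List.cons.injEq,
        and_true] at heq
      obtain ⟨rfl, rfl, rfl⟩ := heq
      refine ⟨fun _ => ⟨some j, fun h => ?_, Relation.ReflTransGen.refl⟩, fun h => ?_⟩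
      · exact h.elim (fun h => hjn h.symm) fun h => hji h
      · exact absurd ⟨hj, hij⟩ h

lemma adj_label_iff [Nonempty U] (hF : M.Faithful) {i : Fin n} :
    M.markovNetwork.Adj (some i) none ↔ i ∈ M.blanket := by
  rw [SimpleGraph.adj_comm]
  refine ⟨fun h => ?_, M.adj_of_mem_blanket hF⟩
  by_contra hi
  exact M.not_adj_of_notMem_blanket hi h

end LatentModel

namespace LatentModel

variable {U : Type w} {n d C : ℕ} {M M' : LatentModel U n d C}

/-! ### The change of latent variables between observationally equivalent models -/

lemma mix_injective (M : LatentModel U n d C) : Function.Injective M.mix := by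
  obtain ⟨h, -, hl⟩ := M.mix_invertible
  exact hl.injective

lemma exists_transition (h : Set.range M'.mix ⊆ Set.range M.mix) :
    ∃ ψ : (Fin n → ℝ) → Fin n → ℝ, ContDiff ℝ ∞ ψ ∧ ∀ z, M.mix (ψ z) = M'.mix z := by
  obtain ⟨g, hg, hl⟩ := M.mix_invertible
  refine ⟨fun z => g (M'.mix z), ?_, fun z => ?_⟩
  · exact hg.comp_contDiff M'.mix_smooth fun z => h (Set.mem_range_self z)
  · obtain ⟨y, hy⟩ := h (Set.mem_range_self z)
    beta_reduce
    rw [← hy, hl y]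

/-- The law of `(Z, Y)`. -/
def pairLaw (M : LatentModel U n d C) (u : U) : Measure ((Fin n → ℝ) × Fin C) :=
  ((volume : Measure (Fin n → ℝ)).prod (Measure.count : Measure (Fin C))).withDensity
        fun q => ENNReal.ofReal (M.dens u q.1 q.2)

lemma obsLaw_eq_map (M : LatentModel U n d C) (u : U) :
    M.obsLaw u = (M.pairLaw u).map (Prod.map M.mix id) := by
  have hm : Measurable (Prod.map M.mix (id : Fin C → Fin C)) :=
    M.mix_smooth.continuous.measurable.prodMap measurable_id
  rw [pairLaw, ← map_splitEquiv_law, Measure.map_map hm (splitEquiv n C).measurable]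
  rfl

lemma pairLaw_prod_singleton (M : LatentModel U n d C) (u : U) {A : Set (Fin n → ℝ)}
    (hA : MeasurableSet A) (c : Fin C) :
    M.pairLaw u (A ×ˢ {c}) = ∫⁻ z in A, ENNReal.ofReal (M.dens u z c) := by
  have hm : Measurable fun q : (Fin n → ℝ) × Fin C => ENNReal.ofReal (M.dens u q.1 q.2) :=
    (M.measurable_dens u).ennreal_ofReal
  rw [pairLaw, withDensity_apply _ (hA.prod (measurableSet_singleton c)),
    setLIntegral_prod _ hm.aemeasurable]
  refine lintegral_congr fun z => ?_
  rw [lintegral_singleton, Measure.count_singleton, mul_one]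

/-- Change of variables gives the identity almost everywhere, and continuity of both sides gives it
everywhere. -/
lemma dens_transition {φ ψ : (Fin n → ℝ) → Fin n → ℝ} (hφ : ContDiff ℝ ∞ φ)
    (hψ : ContDiff ℝ ∞ ψ) (hψφ : Function.LeftInverse ψ φ) (hφψ : Function.RightInverse ψ φ)
    (hmix : ∀ z, M'.mix (φ z) = M.mix z) {u : U} (hobs : M'.obsLaw u = M.obsLaw u)
    (z : Fin n → ℝ) (c : Fin C) :
    M.dens u z c = |(fderiv ℝ φ z).det| * M'.dens u (φ z) c := by
  have hφm : Measurable (Prod.map φ (id : Fin C → Fin C)) :=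
    hφ.continuous.measurable.prodMap measurable_id
  have hemb : MeasurableEmbedding (Prod.map M'.mix (id : Fin C → Fin C)) :=
    (M'.mix_smooth.continuous.prodMap continuous_id).measurableEmbedding
      (M'.mix_injective.prodMap Function.injective_id)
  -- An injective continuous mixing function is a measurable embedding, so the law of the features
  -- determines the law of the latents.
  have hlaw : M'.pairLaw u = (M.pairLaw u).map (Prod.map φ id) := by
    have h1 : (M'.pairLaw u).map (Prod.map M'.mix id) =
        ((M.pairLaw u).map (Prod.map φ id)).map (Prod.map M'.mix id) := by
      rw [← obsLaw_eq_map, hobs, obsLaw_eq_map, Measure.map_map hemb.measurable hφm]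
      congr 1
      funext q
      simp [Prod.map, hmix]
    rw [← hemb.comap_map (M'.pairLaw u), h1, hemb.comap_map]
  have hmd : ∀ (N : LatentModel U n d C), Continuous fun z => N.dens u z c :=
    fun N => (N.dens_diff u c).1.continuous
  have hdet : Continuous fun z => |(fderiv ℝ φ z).det| :=
    (ContinuousLinearMap.continuous_det.comp (hφ.continuous_fderiv (by simp))).abs
  have hcont : Continuous fun z => |(fderiv ℝ φ z).det| * M'.dens u (φ z) c :=
    hdet.mul ((hmd M').comp hφ.continuous)
  have hae : (fun z => ENNReal.ofReal (M.dens u z c)) =ᵐ[volume]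
      fun z => ENNReal.ofReal (|(fderiv ℝ φ z).det| * M'.dens u (φ z) c) := by
    refine ae_eq_of_forall_setLIntegral_eq_of_sigmaFinite (hmd M).measurable.ennreal_ofReal
      hcont.measurable.ennreal_ofReal fun A hA _ => ?_
    have himg : φ '' A = ψ ⁻¹' A := Set.image_eq_preimage_of_inverse hψφ hφψ ▸ rfl
    have hmimg : MeasurableSet (φ '' A) := himg ▸ hψ.continuous.measurable hA
    have hpre : Prod.map φ (id : Fin C → Fin C) ⁻¹' ((φ '' A) ×ˢ {c}) = A ×ˢ {c} := by
      ext q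
      simp [hψφ.injective.mem_set_image]
    rw [← M.pairLaw_prod_singleton u hA c, ← hpre,
      ← Measure.map_apply hφm (hmimg.prod (measurableSet_singleton c)), ← hlaw,
      M'.pairLaw_prod_singleton u hmimg c,
      lintegral_image_eq_lintegral_abs_det_fderiv_mul volume hA
        (fun x _ => ((hφ.differentiable (by simp)) x).hasFDerivAt.hasFDerivWithinAt)
        hψφ.injective.injOn]
    exact lintegral_congr fun z => (ENNReal.ofReal_mul (abs_nonneg _)).symm
  have heq := (Continuous.ae_eq_iff_eq _ (hmd M) hcont).1 (by
    filter_upwards [hae] with z hz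
    exact (ENNReal.ofReal_eq_ofReal_iff (M.dens_pos u z c).le
      (mul_nonneg (abs_nonneg _) (M'.dens_pos u _ c).le)).1 hz)
  exact congrFun heq z

/-- The difference of the log-densities of two domains or labels does not depend on the choice of
latent variables. -/
lemma logDens_sub_transition {φ ψ : (Fin n → ℝ) → Fin n → ℝ} (hφ : ContDiff ℝ ∞ φ)
    (hψ : ContDiff ℝ ∞ ψ) (hψφ : Function.LeftInverse ψ φ) (hφψ : Function.RightInverse ψ φ)
    (hmix : ∀ z, M'.mix (φ z) = M.mix z) (hobs : ∀ u, M'.obsLaw u = M.obsLaw u)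
    (u u' : U) (c c' : Fin C) (y : Fin n → ℝ) :
    M'.logDens u c y - M'.logDens u' c' y =
      M.logDens u c (ψ y) - M.logDens u' c' (ψ y) := by
  have h := fun u c => dens_transition hφ hψ hψφ hφψ hmix (hobs u) (ψ y) c
  simp only [hφψ y] at h
  have hdet : |(fderiv ℝ φ (ψ y)).det| ≠ 0 := fun h0 => by
    have := h u c
    rw [h0, zero_mul] at this
    exact (M.dens_pos u (ψ y) c).ne' this
  unfold logDens
  rw [h u c, h u' c', Real.log_mul hdet (M'.dens_pos u y c).ne',
    Real.log_mul hdet (M'.dens_pos u' y c').ne']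
  ring

end LatentModel

/-! ### Partial derivatives -/

section PartialDeriv

variable {n : ℕ} {f g : (Fin n → ℝ) → ℝ} {ψ : (Fin n → ℝ) → Fin n → ℝ}

lemma partialDeriv_sub (hf : Differentiable ℝ f) (hg : Differentiable ℝ g) (i : Fin n) :
    partialDeriv i (fun z => f z - g z) = fun z => partialDeriv i f z - partialDeriv i g z := by
  funext z
  simp only [partialDeriv]
  rw [fderiv_fun_sub (hf z) (hg z)]
  rfl

lemma contDiff_partialDeriv {m k : WithTop ℕ∞} (hf : ContDiff ℝ k f) (hmk : m + 1 ≤ k)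
    (i : Fin n) : ContDiff ℝ m (partialDeriv i f) :=
  (hf.fderiv_right hmk).clm_apply contDiff_const

lemma partialDeriv_mul {z : Fin n → ℝ} (hf : DifferentiableAt ℝ f z) (hg : DifferentiableAt ℝ g z)
    (i : Fin n) : partialDeriv i (fun z => f z * g z) z =
      f z * partialDeriv i g z + partialDeriv i f z * g z := by
  simp only [partialDeriv]
  rw [fderiv_fun_mul hf hg]
  simp [mul_comm]

lemma partialDeriv_sum {F : Fin n → (Fin n → ℝ) → ℝ} {z : Fin n → ℝ}
    (hF : ∀ j, DifferentiableAt ℝ (F j) z) (i : Fin n) :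
    partialDeriv i (fun z => ∑ j, F j z) z = ∑ j, partialDeriv i (F j) z := by
  simp only [partialDeriv]
  rw [fderiv_fun_sum fun j _ => hF j]
  simp

lemma partialDeriv_comm (hf : ContDiff ℝ 2 f) (i j : Fin n) (z : Fin n → ℝ) :
    partialDeriv i (partialDeriv j f) z = partialDeriv j (partialDeriv i f) z := by
  have hd : DifferentiableAt ℝ (fderiv ℝ f) z :=
    (hf.fderiv_right (m := 1) (by norm_num)).differentiable (by norm_num) z
  have h : ∀ i j, partialDeriv i (partialDeriv j f) z =
      fderiv ℝ (fderiv ℝ f) z (Pi.single i 1) (Pi.single j 1) := by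
    intro i j
    change fderiv ℝ (fun y => fderiv ℝ f y (Pi.single j 1)) z (Pi.single i 1) = _
    rw [fderiv_clm_apply hd (differentiableAt_const _)]
    simp
  rw [h, h]
  exact (hf.contDiffAt.isSymmSndFDerivAt (by simp)) _ _

/-- The Jacobian matrix. -/
def jac (ψ : (Fin n → ℝ) → Fin n → ℝ) (z : Fin n → ℝ) : Fin n → Fin n → ℝ :=
  fun i k => partialDeriv k (fun z => ψ z i) z

lemma jac_apply (z : Fin n → ℝ) (i k : Fin n) :
    jac ψ z i k = partialDeriv k (fun z => ψ z i) z := rfl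

lemma fderiv_single_apply {z : Fin n → ℝ} (hψ : DifferentiableAt ℝ ψ z) (i k : Fin n) :
    fderiv ℝ ψ z (Pi.single k 1) i = jac ψ z i k := by
  rw [jac_apply, partialDeriv, fderiv_pi (differentiableAt_pi.1 hψ)]
  rfl

lemma clm_apply_eq_sum {E : Type*} [NormedAddCommGroup E] [NormedSpace ℝ E]
    (L : (Fin n → ℝ) →L[ℝ] E) (v : Fin n → ℝ) : L v = ∑ i, v i • L (Pi.single i 1) := by
  conv_lhs => rw [pi_eq_sum_univ' v, map_sum]
  refine Finset.sum_congr rfl fun i _ => ?_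
  rw [map_smul]

lemma partialDeriv_comp {z : Fin n → ℝ} (hf : DifferentiableAt ℝ f (ψ z))
    (hψ : DifferentiableAt ℝ ψ z) (k : Fin n) :
    partialDeriv k (fun z => f (ψ z)) z = ∑ i, partialDeriv i f (ψ z) * jac ψ z i k := by
  have : fderiv ℝ (fun z => f (ψ z)) z = (fderiv ℝ f (ψ z)).comp (fderiv ℝ ψ z) :=
    fderiv_comp z hf hψ
  rw [partialDeriv, this, ContinuousLinearMap.comp_apply, clm_apply_eq_sum]
  refine Finset.sum_congr rfl fun i _ => ?_
  rw [fderiv_single_apply hψ, smul_eq_mul, mul_comm]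
  rfl

lemma partialDeriv_partialDeriv_comp (hf : ContDiff ℝ 2 f) (hψ : ContDiff ℝ ∞ ψ) (k l : Fin n)
    (z : Fin n → ℝ) :
    partialDeriv l (partialDeriv k fun z => f (ψ z)) z =
      (∑ i, partialDeriv i f (ψ z) * partialDeriv l (fun z => jac ψ z i k) z) +
        ∑ i, ∑ j, partialDeriv j (partialDeriv i f) (ψ z) * jac ψ z j l * jac ψ z i k := by
  have hfd := hf.differentiable (by norm_num)
  have hψd := hψ.differentiable (by simp)
  have hfi : ∀ i, Differentiable ℝ (partialDeriv i f) := fun i =>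
    (contDiff_partialDeriv (m := 1) hf (by norm_num) i).differentiable (by norm_num)
  have hJ : ∀ i k, Differentiable ℝ fun z => jac ψ z i k := fun i k =>
    (contDiff_partialDeriv (m := 1) (contDiff_pi.1 hψ i)
      (by norm_cast) k).differentiable (by norm_num)
  have h1 : (partialDeriv k fun z => f (ψ z)) =
      fun z => ∑ i, partialDeriv i f (ψ z) * jac ψ z i k :=
    funext fun z => partialDeriv_comp (hfd _) (hψd z) k
  have hc : ∀ i, DifferentiableAt ℝ (fun z => partialDeriv i f (ψ z)) z := fun i =>
    (hfi i (ψ z)).comp z (hψd z)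
  have hm : ∀ i, DifferentiableAt ℝ (fun z => partialDeriv i f (ψ z) * jac ψ z i k) z :=
    fun i => (hc i).mul (hJ i k z)
  rw [h1, partialDeriv_sum hm, ← Finset.sum_add_distrib]
  refine Finset.sum_congr rfl fun i _ => ?_
  rw [partialDeriv_mul (hc i) (hJ i k z) l, partialDeriv_comp (hfi i (ψ z)) (hψd z),
    Finset.sum_mul]

end PartialDeriv

/-! ### Linear algebra -/

/-- As many independent vectors as coordinates span the space. This is how sufficient changes make
coefficients vanish. -/
lemma eq_zero_of_linearIndependent {ι κ : Type*} [Fintype ι] [Fintype κ] {v : ι → κ → ℝ}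
    (hv : LinearIndependent ℝ v) (hcard : Fintype.card ι = Fintype.card κ) {c : κ → ℝ}
    (hc : ∀ k, ∑ x, c x * v k x = 0) : c = 0 := by
  classical
  have hspan : Submodule.span ℝ (Set.range v) = ⊤ :=
    hv.span_eq_top_of_card_eq_finrank' (by simpa using hcard)
  have hL : (∑ x, c x • (LinearMap.proj x : (κ → ℝ) →ₗ[ℝ] ℝ)) = 0 := by
    refine LinearMap.ext_on_range hspan fun k => ?_
    simpa using hc k
  funext x
  have := LinearMap.congr_fun hL (Pi.single x 1)
  simpa [Pi.single_apply] using this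

/-- Regroups the double sum of the chain rule by the second-order coordinates of `wVec`: one term
per variable and one per latent edge. -/
lemma sum_sum_eq_diag_add_pairs {n : ℕ} (F : Fin n → Fin n → ℝ) (p : Fin n × Fin n → Prop)
    [Fintype {e : Fin n × Fin n // e.1 < e.2 ∧ p e}]
    (h : ∀ i j, i < j → ¬ p (i, j) → F i j + F j i = 0) :
    ∑ i, ∑ j, F i j = ∑ i, F i i +
      ∑ e : {e : Fin n × Fin n // e.1 < e.2 ∧ p e}, (F e.1.1 e.1.2 + F e.1.2 e.1.1) := by
  classical
  have h1 : ∑ e : {e : Fin n × Fin n // e.1 < e.2 ∧ p e}, (F e.1.1 e.1.2 + F e.1.2 e.1.1) =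
      ∑ e : Fin n × Fin n, if e.1 < e.2 then F e.1 e.2 + F e.2 e.1 else 0 := by
    rw [← Finset.sum_filter, ← Finset.sum_subtype
      (Finset.univ.filter fun e : Fin n × Fin n => e.1 < e.2 ∧ p e) (by simp)
      fun e : Fin n × Fin n => F e.1 e.2 + F e.2 e.1]
    refine Finset.sum_subset (fun e he => ?_) fun e he he' => ?_
    · rw [Finset.mem_filter_univ] at he ⊢
      exact he.1
    · rw [Finset.mem_filter_univ] at he he'
      exact h _ _ he fun hp => he' ⟨he, hp⟩
  have h2 : ∑ e : Fin n × Fin n, (if e.1 < e.2 then F e.2 e.1 else 0) =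
      ∑ e : Fin n × Fin n, if e.2 < e.1 then F e.1 e.2 else 0 :=
    Fintype.sum_equiv (Equiv.prodComm _ _) _ _ fun e => rfl
  have h3 : ∑ i, F i i = ∑ e : Fin n × Fin n, if e.1 = e.2 then F e.1 e.2 else 0 := by
    rw [Fintype.sum_prod_type]
    simp
  have h4 : ∑ e : Fin n × Fin n, (if e.1 < e.2 then F e.1 e.2 + F e.2 e.1 else 0) =
      (∑ e : Fin n × Fin n, if e.1 < e.2 then F e.1 e.2 else 0) +
        ∑ e : Fin n × Fin n, if e.1 < e.2 then F e.2 e.1 else 0 := by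
    rw [← Finset.sum_add_distrib]
    exact Finset.sum_congr rfl fun e _ => by split_ifs <;> simp
  rw [h1, h4, h2, h3, ← Fintype.sum_prod_type', ← Finset.sum_add_distrib, ← Finset.sum_add_distrib]
  refine Finset.sum_congr rfl fun e _ => ?_
  rcases lt_trichotomy e.1 e.2 with hlt | heq | hgt
  · simp [hlt, hlt.ne, hlt.not_gt]
  · simp [heq]
  · simp [hgt, hgt.ne', hgt.not_gt]

/-! ### Zeros of the Jacobian matrix of the transition -/

namespace LatentModel

variable {U : Type w} {n d C : ℕ} {M M' : LatentModel U n d C}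
  {φ ψ : (Fin n → ℝ) → Fin n → ℝ}

/-- `φ` maps the latent variables of `M` to those of the observationally equivalent model `M'`,
and `ψ` is its inverse. -/
structure IsTransition (M M' : LatentModel U n d C) (φ ψ : (Fin n → ℝ) → Fin n → ℝ) : Prop where
  contDiff : ContDiff ℝ ∞ φ
  contDiff_inv : ContDiff ℝ ∞ ψ
  leftInverse : Function.LeftInverse ψ φ
  rightInverse : Function.RightInverse ψ φ
  mix_eq : ∀ z, M'.mix (φ z) = M.mix z
  obsLaw_eq : ∀ u, M'.obsLaw u = M.obsLaw u

lemma ObsEquiv.exists_isTransition (h : M.ObsEquiv M') : ∃ φ ψ, IsTransition M M' φ ψ := by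
  obtain ⟨φ, hφ, hφm⟩ := exists_transition (M := M') (M' := M) h.1.ge
  obtain ⟨ψ, hψ, hψm⟩ := exists_transition (M := M) (M' := M') h.1.le
  exact ⟨φ, ψ, hφ, hψ, fun z => M.mix_injective (by rw [hψm, hφm]),
    fun z => M'.mix_injective (by rw [hφm, hψm]), hφm, h.2⟩

namespace IsTransition

lemma logDens_sub (T : IsTransition M M' φ ψ) (u u' : U) (c c' : Fin C) :
    (fun y => M'.logDens u c y - M'.logDens u' c' y) =
      fun y => (fun z => M.logDens u c z - M.logDens u' c' z) (ψ y) :=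
  funext fun y => logDens_sub_transition T.contDiff T.contDiff_inv T.leftInverse T.rightInverse
    T.mix_eq T.obsLaw_eq u u' c c' y

lemma sum_hessian_eq_zero [NeZero C] (T : IsTransition M M' φ ψ) {k l : Fin n} (hkl : k ≠ l)
    (hadj : ¬ M'.markovNetwork.Adj (some k) (some l)) (u u' : U) (c : Fin C) (y : Fin n → ℝ) :
    (∑ i, (partialDeriv i (M.logDens u c) (ψ y) - partialDeriv i (M.logDens u' c) (ψ y)) *
        partialDeriv l (fun z => jac ψ z i k) y) +
      ∑ i, ∑ j, (partialDeriv j (partialDeriv i (M.logDens u c)) (ψ y) -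
        partialDeriv j (partialDeriv i (M.logDens u' c)) (ψ y)) * jac ψ y j l * jac ψ y i k =
      0 := by
  have hd : ∀ (N : LatentModel U n d C) u, Differentiable ℝ (N.logDens u c) := fun N u =>
    (N.contDiff_logDens u c).differentiable (by norm_num)
  have hd2 : ∀ (N : LatentModel U n d C) u i,
      Differentiable ℝ (partialDeriv i (N.logDens u c)) := fun N u i =>
    (contDiff_partialDeriv (m := 1) (N.contDiff_logDens u c) (by norm_num) i).differentiable
      (by norm_num)
  have h := partialDeriv_partialDeriv_comp
    ((M.contDiff_logDens u c).sub (M.contDiff_logDens u' c)) T.contDiff_inv k l y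
  rw [← T.logDens_sub u u' c c, partialDeriv_sub (hd M' u) (hd M' u'),
    partialDeriv_sub (hd2 M' u k) (hd2 M' u' k)] at h
  have h0 := fun u => M'.partialDeriv_partialDeriv_logDens_eq_zero hkl.symm
    (fun h => hadj h.symm) u c y
  simp only [partialDeriv_sub (hd M u) (hd M u'), h0,
    partialDeriv_sub (hd2 M u _) (hd2 M u' _), sub_self] at h
  exact h.symm

/-- If `k` and `l` are not adjacent in `M'`, then no latent variable, and no pair of adjacent latent
variables, of `M` depends on both of them. -/
lemma jac_mul_jac_eq_zero [NeZero C] (T : IsTransition M M' φ ψ) (hZ : M.SufficientChangesZ)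
    {k l : Fin n} (hkl : k ≠ l) (hadj : ¬ M'.markovNetwork.Adj (some k) (some l))
    (y : Fin n → ℝ) {i j : Fin n} (hij : i = j ∨ M.markovNetwork.Adj (some i) (some j)) :
    jac ψ y i k * jac ψ y j l = 0 := by
  classical
  obtain ⟨c, u, hu⟩ := hZ (ψ y)
  set a : Fin n → ℝ := fun i => jac ψ y i k
  set b : Fin n → ℝ := fun i => jac ψ y i l
  -- The coefficients of `sum_hessian_eq_zero`, read as a linear form in the difference of two
  -- vectors `wVec`; they do not depend on the domains.
  set coef : Fin n ⊕ Fin n ⊕ M.LatentEdge → ℝ := fun x => match x with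
    | .inl i => partialDeriv l (fun z => jac ψ z i k) y
    | .inr (.inl i) => a i * b i
    | .inr (.inr e) => a e.1.1 * b e.1.2 + a e.1.2 * b e.1.1 with hcoef
  have hc2 := M.contDiff_logDens
  have hzero : coef = 0 := by
    refine eq_zero_of_linearIndependent hu ?_ fun m => ?_
    · simp only [Fintype.card_fin, Fintype.card_sum, Nat.card_eq_fintype_card]
      ring
    · have hs := T.sum_hessian_eq_zero hkl hadj (u m.succ) (u 0) c y
      rw [sum_sum_eq_diag_add_pairs _
        (fun e : Fin n × Fin n => M.markovNetwork.Adj (some e.1) (some e.2))] at hs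
      · rw [Fintype.sum_sum_type, Fintype.sum_sum_type, ← hs]
        congr 1
        · exact Finset.sum_congr rfl fun i _ => mul_comm _ _
        · congr 1
          · refine Finset.sum_congr rfl fun i _ => ?_
            change a i * b i * (partialDeriv i (partialDeriv i _) _ -
              partialDeriv i (partialDeriv i _) _) = _ * b i * a i
            ring
          · refine Finset.sum_congr rfl fun e _ => ?_
            rw [partialDeriv_comm (hc2 (u m.succ) c) e.1.2 e.1.1,
              partialDeriv_comm (hc2 (u 0) c) e.1.2 e.1.1]
            change (a e.1.1 * b e.1.2 + a e.1.2 * b e.1.1) *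
              (partialDeriv e.1.1 (partialDeriv e.1.2 _) _ -
                partialDeriv e.1.1 (partialDeriv e.1.2 _) _) =
              _ * b e.1.2 * a e.1.1 + _ * b e.1.1 * a e.1.2
            ring
      · intro i j hlt hna
        have h1 := fun u => M.partialDeriv_partialDeriv_logDens_eq_zero hlt.ne hna u c (ψ y)
        have h2 := fun u => M.partialDeriv_partialDeriv_logDens_eq_zero hlt.ne'
          (fun h => hna h.symm) u c (ψ y)
        simp [h1, h2]
  have hdiag : ∀ i, a i * b i = 0 := fun i => congrFun hzero (.inr (.inl i))
  have hpair : ∀ i j, M.markovNetwork.Adj (some i) (some j) → i < j →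
      a i * b j + a j * b i = 0 := fun i j h hlt =>
    congrFun hzero (.inr (.inr ⟨(i, j), hlt, h⟩))
  -- The product of the two summands is zero by `hdiag`; as their sum is zero too, each summand
  -- vanishes.
  have hsplit : ∀ i j, a i * b j + a j * b i = 0 → a i * b j = 0 := by
    intro i j h
    have h1 : (a i * b j) * (a i * b j) = 0 := by
      calc (a i * b j) * (a i * b j) =
          (a i * b j) * (a i * b j + a j * b i) - (a i * b i) * (a j * b j) := by ring
        _ = 0 := by rw [h, hdiag i]; ring
    exact mul_self_eq_zero.1 h1
  rcases hij with rfl | hij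
  · exact hdiag i
  · have hne : i ≠ j := fun h => hij.ne (congrArg some h)
    rcases hne.lt_or_gt with hlt | hgt
    · exact hsplit i j (hpair i j hij hlt)
    · exact hsplit i j (by rw [add_comm]; exact hpair j i hij.symm hgt)

/-- If `k` is not adjacent to the label in `M'`, then the Markov blanket of `M` does not depend
on `k`. -/
lemma jac_eq_zero_of_mem_blanket [NeZero C] [Nonempty U] (T : IsTransition M M' φ ψ)
    (hF : M.Faithful) (hY : M.SufficientChangesY) {k : Fin n}
    (hadj : ¬ M'.markovNetwork.Adj (some k) none) (y : Fin n → ℝ) {i : Fin n}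
    (hi : i ∈ M.blanket) : jac ψ y i k = 0 := by
  classical
  obtain ⟨c₁, u, c, -, hu⟩ := hY (ψ y)
  have hzero : (fun x : M.blanket => jac ψ y x.1 k) = 0 := by
    refine eq_zero_of_linearIndependent hu (by simp) fun m => ?_
    have hd : ∀ (N : LatentModel U n d C) u c, Differentiable ℝ (N.logDens u c) := fun N u c =>
      (N.contDiff_logDens u c).differentiable (by norm_num)
    have h := partialDeriv_comp (k := k)
      (((hd M (u m) (c m)).sub (hd M (u m) c₁)) (ψ y))
      (T.contDiff_inv.differentiable (by simp) y)
    have h' : partialDeriv k (fun y => M'.logDens (u m) (c m) y - M'.logDens (u m) c₁ y) y = 0 := by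
      rw [partialDeriv_sub (hd M' _ _) (hd M' _ _)]
      exact sub_eq_zero.2 (M'.partialDeriv_logDens_eq hadj _ _ _ _)
    rw [T.logDens_sub] at h'
    have h'' := h.symm.trans h'
    have hsub : ∀ i, partialDeriv i (M.logDens (u m) (c m) - M.logDens (u m) c₁) (ψ y) =
        partialDeriv i (M.logDens (u m) (c m)) (ψ y) - partialDeriv i (M.logDens (u m) c₁) (ψ y) :=
      fun i => congrFun (partialDeriv_sub (hd M _ _) (hd M _ _) i) (ψ y)
    simp only [hsub] at h''
    set G : Fin n → ℝ := fun i => (partialDeriv i (M.logDens (u m) (c m)) (ψ y) -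
      partialDeriv i (M.logDens (u m) c₁) (ψ y)) * jac ψ y i k
    calc _ = ∑ x : M.blanket, G x.1 := Finset.sum_congr rfl fun i _ => mul_comm _ _
      _ = ∑ i ∈ M.blanket, G i := Finset.sum_coe_sort _ G
      -- Outside the blanket the label difference has zero derivative, so these terms add nothing.
      _ = ∑ i, G i := Finset.sum_subset (Finset.subset_univ _) fun i _ hi => by
        simp only [G]
        rw [M.partialDeriv_logDens_eq (fun h => hi ((M.adj_label_iff hF).1 h)) (u m) (c m) c₁,
          sub_self, zero_mul]
      _ = 0 := h''
  exact congrFun hzero ⟨i, hi⟩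

lemma jac_mul_jac_inv (T : IsTransition M M' φ ψ) (y : Fin n → ℝ) :
    Matrix.of (jac ψ y) * Matrix.of (jac φ (ψ y)) = 1 := by
  ext i k
  have h := partialDeriv_comp (f := fun y => ψ y i) (ψ := φ) (z := ψ y) (k := k)
    (differentiableAt_pi.1 (T.contDiff_inv.differentiable (by simp) _) i)
    (T.contDiff.differentiable (by simp) _)
  rw [T.rightInverse y] at h
  simp only [T.leftInverse _] at h
  rw [Matrix.mul_apply]
  refine h.symm.trans ?_
  have : fderiv ℝ (fun z : Fin n → ℝ => z i) (ψ y) =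
      ContinuousLinearMap.proj (R := ℝ) (φ := fun _ : Fin n => ℝ) i :=
    (ContinuousLinearMap.proj (R := ℝ) (φ := fun _ : Fin n => ℝ) i).fderiv
  rw [partialDeriv, this]
  simp [Matrix.one_apply, Pi.single_apply]

/-- The Jacobian matrix is invertible, so some term of the Leibniz expansion of its determinant is
nonzero. The permutation depends on `y`. -/
lemma exists_perm (T : IsTransition M M' φ ψ) (y : Fin n → ℝ) :
    ∃ σ : Equiv.Perm (Fin n), ∀ i, jac ψ y i (σ i) ≠ 0 := by
  have hdet : (Matrix.of (jac ψ y)).det ≠ 0 := fun h0 => by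
    have := congrArg Matrix.det (T.jac_mul_jac_inv y)
    rw [Matrix.det_mul, h0, zero_mul, Matrix.det_one] at this
    exact zero_ne_one this
  rw [Matrix.det_apply] at hdet
  obtain ⟨σ, -, hσ⟩ := Finset.exists_ne_zero_of_sum_ne_zero hdet
  have hprod : ∏ i, Matrix.of (jac ψ y) (σ i) i ≠ 0 := fun h => hσ (by rw [h, smul_zero])
  rw [Finset.prod_ne_zero_iff] at hprod
  exact ⟨σ⁻¹, fun i => by simpa using hprod (σ⁻¹ i) (Finset.mem_univ _)⟩

end IsTransition

end LatentModel

/-- An injective map of graphs that preserves adjacency, to a graph with at most as many edges,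
also reflects adjacency. -/
lemma adj_of_adj_map {V W : Type*} [Finite V] [Finite W] {G : SimpleGraph V} {H : SimpleGraph W}
    {f : V → W} (hf : Function.Injective f) (hadj : ∀ a b, G.Adj a b → H.Adj (f a) (f b))
    (hcard : H.edgeSet.ncard ≤ G.edgeSet.ncard) {a b : V} (h : H.Adj (f a) (f b)) :
    G.Adj a b := by
  have hsub : Sym2.map f '' G.edgeSet ⊆ H.edgeSet := by
    rintro _ ⟨e, he, rfl⟩
    induction e using Sym2.ind with
    | _ x y => exact hadj x y he
  have heq := Set.eq_of_subset_of_ncard_le hsub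
    (by rwa [Set.ncard_image_of_injective _ (Sym2.map.injective hf)]) (Set.toFinite _)
  have hmem : s(f a, f b) ∈ Sym2.map f '' G.edgeSet := heq ▸ h
  obtain ⟨e, he, heq'⟩ := hmem
  have : e = s(a, b) := Sym2.map.injective hf heq'
  rw [this] at he
  exact he

/-! ### Isomorphism of the Markov networks -/

namespace LatentModel.IsTransition

variable {U : Type w} {n d C : ℕ} {M M' : LatentModel U n d C}
  {φ ψ : (Fin n → ℝ) → Fin n → ℝ} [NeZero C] [Nonempty U]

lemma adj_map (T : IsTransition M M' φ ψ) (hZ : M.SufficientChangesZ) {y : Fin n → ℝ} {i j k l : Fin n}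
    (hik : jac ψ y i k ≠ 0) (hjl : jac ψ y j l ≠ 0) (hkl : k ≠ l)
    (hij : i = j ∨ M.markovNetwork.Adj (some i) (some j)) :
    M'.markovNetwork.Adj (some k) (some l) := by
  by_contra hadj
  exact mul_ne_zero hik hjl (T.jac_mul_jac_eq_zero hZ hkl hadj y hij)

lemma adj_label_map (T : IsTransition M M' φ ψ) (hF : M.Faithful)
    (hY : M.SufficientChangesY) {y : Fin n → ℝ} {i k : Fin n}
    (hik : jac ψ y i k ≠ 0) (hi : M.markovNetwork.Adj (some i) none) :
    M'.markovNetwork.Adj (some k) none := by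
  by_contra hadj
  exact hik (T.jac_eq_zero_of_mem_blanket hF hY hadj y ((M.adj_label_iff hF).1 hi))

/-- At each point, a permutation along nonzero entries of the Jacobian matrix is an isomorphism of
the Markov networks. -/
lemma adj_iff (T : IsTransition M M' φ ψ) (hF : M.Faithful) (hZ : M.SufficientChangesZ)
    (hY : M.SufficientChangesY) (hcard : M'.edgeCount ≤ M.edgeCount) {y : Fin n → ℝ}
    {σ : Equiv.Perm (Fin n)} (hσ : ∀ i, jac ψ y i (σ i) ≠ 0) (a b : Node n) :
    M'.markovNetwork.Adj (a.map σ) (b.map σ) ↔ M.markovNetwork.Adj a b := by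
  have hhom : ∀ a b : Node n, M.markovNetwork.Adj a b →
      M'.markovNetwork.Adj (a.map σ) (b.map σ) := by
    rintro (_ | i) (_ | j) h
    · exact absurd rfl h.ne
    · exact (T.adj_label_map hF hY (hσ j) h.symm).symm
    · exact T.adj_label_map hF hY (hσ i) h
    · exact T.adj_map hZ (hσ i) (hσ j)
        (fun h' => h.ne (congrArg some (σ.injective h'))) (Or.inr h)
  exact ⟨adj_of_adj_map (Option.map_injective σ.injective) hhom hcard, hhom a b⟩

/-- A row of the Jacobian matrix is supported on the variable and its intimate neighbors. -/
lemma eq_or_intimateNeighbor (T : IsTransition M M' φ ψ) (hF : M.Faithful)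
    (hZ : M.SufficientChangesZ) (hY : M.SufficientChangesY)
    (hcard : M'.edgeCount ≤ M.edgeCount) {y : Fin n → ℝ} {σ : Equiv.Perm (Fin n)}
    (hσ : ∀ i, jac ψ y i (σ i) ≠ 0) {i j : Fin n} (hij : jac ψ y i (σ j) ≠ 0) :
    j = i ∨ M.IntimateNeighbor j i := by
  rw [or_iff_not_imp_left]
  intro hne
  have hiff := T.adj_iff hF hZ hY hcard hσ
  -- Two nonzero entries in the same row `i` make their columns `σ j` and `σ i` adjacent in `M'`;
  -- the isomorphism pulls this back to `M`.
  refine ⟨(hiff (some j) (some i)).1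
    (T.adj_map hZ hij (hσ i) (fun h => hne (σ.injective h)) (Or.inl rfl)), ?_⟩
  rintro (_ | m) ha hm
  · exact (hiff (some j) none).1 (T.adj_label_map hF hY hij ha.symm)
  · exact (hiff (some j) (some m)).1 (T.adj_map hZ hij (hσ m)
      (fun h => hm (congrArg some (σ.injective h).symm)) (Or.inr ha.symm))

end LatentModel.IsTransition

/-! ### Constant supports and block diffeomorphisms -/

lemma eq_of_partialDeriv_eq_zero {n : ℕ} {f : (Fin n → ℝ) → ℝ} (hf : Differentiable ℝ f)
    {S : Finset (Fin n)} (h : ∀ y, ∀ k ∉ S, partialDeriv k f y = 0) {y y' : Fin n → ℝ}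
    (hy : ∀ k ∈ S, y k = y' k) : f y = f y' := by
  have hline : ∀ t : ℝ, HasDerivAt (fun t : ℝ => y + t • (y' - y)) (y' - y) t := fun t => by
    simpa using ((hasDerivAt_id t).smul_const (y' - y)).const_add y
  have hg : ∀ t : ℝ, HasDerivAt (fun t : ℝ => f (y + t • (y' - y))) 0 t := by
    intro t
    have h1 := (hf (y + t • (y' - y))).hasFDerivAt.comp_hasDerivAt t (hline t)
    have h2 : fderiv ℝ f (y + t • (y' - y)) (y' - y) = 0 := by
      rw [clm_apply_eq_sum]
      refine Finset.sum_eq_zero fun k _ => ?_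
      by_cases hk : k ∈ S
      · simp [hy k hk]
      · rw [show fderiv ℝ f (y + t • (y' - y)) (Pi.single k 1) = 0 from h _ k hk, smul_zero]
    rwa [h2] at h1
  have := is_const_of_deriv_eq_zero (fun t => (hg t).differentiableAt) (fun t => (hg t).deriv) 0 1
  simpa using this

/-- The rows `G` of `A * B = 1` only involve the block of `A` on `G × S`. This block is square with
a right inverse, hence invertible, and it annihilates the part in `S` of every column of `B` outside
`G`. -/
lemma inverse_block_eq_zero {m : Type*} [Fintype m] [DecidableEq m] {A B : Matrix m m ℝ}
    (hAB : A * B = 1) {G S : Finset m} (hcard : G.card = S.card)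
    (hA : ∀ i ∈ G, ∀ k ∉ S, A i k = 0) {k i : m} (hk : k ∈ S) (hi : i ∉ G) : B k i = 0 := by
  have hsum : ∀ g ∈ G, ∀ j, ∑ k : S, A g k * B k j = (1 : Matrix m m ℝ) g j := by
    intro g hg j
    rw [← hAB, Matrix.mul_apply, Finset.sum_coe_sort S fun k => A g k * B k j]
    exact Finset.sum_subset (Finset.subset_univ S) fun k _ hk => by rw [hA g hg k hk, zero_mul]
  set A' : Matrix G S ℝ := Matrix.of fun g k => A g k
  set B' : Matrix S G ℝ := Matrix.of fun k g => B k g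
  have h1 : A' * B' = 1 := by
    ext g g'
    rw [Matrix.mul_apply]
    refine (hsum g.1 g.2 g'.1).trans ?_
    simp only [Matrix.one_apply, Subtype.ext_iff]
  have h2 : B' * A' = 1 := (Matrix.mul_eq_one_comm_of_card_eq _ _ _ (by simpa using hcard)).1 h1
  have h3 : A'.mulVec (fun k : S => B k i) = 0 := by
    funext g
    refine (hsum g.1 g.2 i).trans ?_
    exact Matrix.one_apply_ne fun h => hi (h ▸ g.2 : i ∈ G)
  have h4 : (B' * A').mulVec (fun k : S => B k i) = 0 := by
    rw [← Matrix.mulVec_mulVec, h3, Matrix.mulVec_zero]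
  rw [h2, Matrix.one_mulVec] at h4
  exact congrFun h4 ⟨k, hk⟩

open scoped Classical in
/-- The columns on which the rows `G` of the Jacobian matrix do not vanish. -/
def rowSupport {n : ℕ} (ψ : (Fin n → ℝ) → Fin n → ℝ) (G : Finset (Fin n)) (y : Fin n → ℝ) :
    Finset (Fin n) :=
  {k | ∃ i ∈ G, jac ψ y i k ≠ 0}

lemma mem_rowSupport {n : ℕ} {ψ : (Fin n → ℝ) → Fin n → ℝ} {G : Finset (Fin n)}
    {y : Fin n → ℝ} {k : Fin n} : k ∈ rowSupport ψ G y ↔ ∃ i ∈ G, jac ψ y i k ≠ 0 := by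
  classical
  unfold rowSupport
  rw [Finset.mem_filter_univ]

lemma continuous_jac {n : ℕ} {ψ : (Fin n → ℝ) → Fin n → ℝ} (hψ : ContDiff ℝ ∞ ψ)
    (i k : Fin n) : Continuous fun y => jac ψ y i k :=
  (contDiff_partialDeriv (m := 0) (contDiff_pi.1 hψ i) (by simp) k).continuous

/-- If the number of columns on which the rows `G` do not vanish is the same everywhere, then
these columns are the same everywhere. -/
lemma rowSupport_eq_of_card_eq {n : ℕ} {ψ : (Fin n → ℝ) → Fin n → ℝ} (hψ : ContDiff ℝ ∞ ψ)
    {G : Finset (Fin n)} {N : ℕ} (hcard : ∀ y, (rowSupport ψ G y).card = N) (y y' : Fin n → ℝ) :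
    rowSupport ψ G y = rowSupport ψ G y' := by
  have hloc : IsLocallyConstant (rowSupport ψ G) := by
    rw [IsLocallyConstant.iff_eventually_eq]
    intro y
    -- Being nonzero is an open condition, so the support can only grow nearby; its constant size
    -- forbids growth.
    have hev : ∀ k ∈ rowSupport ψ G y, ∀ᶠ y' in nhds y, k ∈ rowSupport ψ G y' := by
      intro k hk
      obtain ⟨i, hi, hik⟩ := mem_rowSupport.1 hk
      filter_upwards [(continuous_jac hψ i k).continuousAt.eventually_ne hik] with y' hy'
      exact mem_rowSupport.2 ⟨i, hi, hy'⟩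
    rw [← Filter.eventually_all_finset] at hev
    filter_upwards [hev] with y' hy'
    exact (Finset.eq_of_subset_of_card_le hy' (by rw [hcard, hcard])).symm
  exact hloc.apply_eq_of_preconnectedSpace y y'

namespace LatentModel.IsTransition

variable {U : Type w} {n d C : ℕ} {M M' : LatentModel U n d C}
  {φ ψ : (Fin n → ℝ) → Fin n → ℝ}

lemma rowSupport_eq_image [NeZero C] [Nonempty U] (T : IsTransition M M' φ ψ) (hF : M.Faithful)
    (hZ : M.SufficientChangesZ) (hY : M.SufficientChangesY)
    (hcard : M'.edgeCount ≤ M.edgeCount) {y : Fin n → ℝ} {σ : Equiv.Perm (Fin n)}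
    (hσ : ∀ i, jac ψ y i (σ i) ≠ 0) {G : Finset (Fin n)}
    (hG : ∀ i j, M.IntimateNeighbor i j → j ∈ G → i ∈ G) :
    rowSupport ψ G y = G.image σ := by
  ext k
  rw [mem_rowSupport, Finset.mem_image]
  constructor
  · rintro ⟨i, hi, hik⟩
    refine ⟨σ.symm k, ?_, σ.apply_symm_apply k⟩
    rw [← σ.apply_symm_apply k] at hik
    rcases T.eq_or_intimateNeighbor hF hZ hY hcard hσ hik with h | h
    · rwa [h]
    · exact hG _ _ h hi
  · rintro ⟨i, hi, rfl⟩
    exact ⟨i, hi, hσ i⟩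

/-- The permutation may vary with the point, but the size of the image of `G` does not. -/
lemma rowSupport_const [NeZero C] [Nonempty U] (T : IsTransition M M' φ ψ) (hF : M.Faithful)
    (hZ : M.SufficientChangesZ) (hY : M.SufficientChangesY)
    (hcard : M'.edgeCount ≤ M.edgeCount) {G : Finset (Fin n)}
    (hG : ∀ i j, M.IntimateNeighbor i j → j ∈ G → i ∈ G) (y y' : Fin n → ℝ) :
    rowSupport ψ G y = rowSupport ψ G y' := by
  refine rowSupport_eq_of_card_eq T.contDiff_inv (N := G.card) (fun y => ?_) y y'
  obtain ⟨σ, hσ⟩ := T.exists_perm y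
  rw [T.rowSupport_eq_image hF hZ hY hcard hσ hG, Finset.card_image_of_injective _ σ.injective]

/-- The point with the coordinates `a` on `A` and zeros elsewhere. -/
def extendZero (A : Finset (Fin n)) (a : A → ℝ) : Fin n → ℝ :=
  fun i => if h : i ∈ A then a ⟨i, h⟩ else 0

lemma extendZero_of_mem {A : Finset (Fin n)} (a : A → ℝ) {i : Fin n} (h : i ∈ A) :
    extendZero A a i = a ⟨i, h⟩ := dif_pos h

lemma contDiff_extendZero (A : Finset (Fin n)) : ContDiff ℝ ∞ (extendZero A) := by
  refine contDiff_pi.2 fun i => ?_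
  by_cases h : i ∈ A <;> simp only [extendZero, h, dite_true, dite_false] <;> fun_prop

/-- The zeros make the `A`-part of `ψ` a function of the coordinates in `S`. Equal sizes carry the
zeros over to the inverse Jacobian, so the `S`-part of `φ` is a function of those in `A`, and
padding by zeros is harmless. -/
lemma blockInvertible (T : IsTransition M M' φ ψ) {A S : Finset (Fin n)}
    (hcard : A.card = S.card) (hzero : ∀ y, ∀ i ∈ A, ∀ k ∉ S, jac ψ y i k = 0) :
    M.BlockInvertible M' A S := by
  have hψdep : ∀ y y' : Fin n → ℝ, (∀ k ∈ S, y k = y' k) → ∀ i ∈ A, ψ y i = ψ y' i :=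
    fun y y' h i hi => eq_of_partialDeriv_eq_zero (f := fun y => ψ y i)
      (differentiable_pi.1 (T.contDiff_inv.differentiable (by simp)) i)
      (fun y k hk => hzero y i hi k hk) h
  have hφdep : ∀ z z' : Fin n → ℝ, (∀ i ∈ A, z i = z' i) → ∀ k ∈ S, φ z k = φ z' k :=
    fun z z' h k hk => eq_of_partialDeriv_eq_zero (f := fun z => φ z k)
      (differentiable_pi.1 (T.contDiff.differentiable (by simp)) k)
      (fun z i hi => by
        have hAB := T.jac_mul_jac_inv (φ z)
        rw [T.leftInverse z] at hAB
        exact inverse_block_eq_zero hAB hcard (fun i hi k hk => hzero _ i hi k hk) hk hi) h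
  refine ⟨⟨fun a k => φ (extendZero A a) k, fun b i => ψ (extendZero S b) i, fun a => ?_,
    fun b => ?_⟩, ?_, ?_, fun z z' hz => ?_⟩
  · funext i
    have h := hψdep (extendZero S fun k => φ (extendZero A a) k) (φ (extendZero A a))
      (fun k hk => extendZero_of_mem _ hk) i.1 i.2
    rw [T.leftInverse, extendZero_of_mem a i.2] at h
    exact h
  · funext k
    have h := hφdep (extendZero A fun i => ψ (extendZero S b) i) (ψ (extendZero S b))
      (fun i hi => extendZero_of_mem _ hi) k.1 k.2
    rw [T.rightInverse, extendZero_of_mem b k.2] at h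
    exact h
  · exact contDiff_pi.2 fun k => (contDiff_pi.1 T.contDiff k.1).comp (contDiff_extendZero A)
  · exact contDiff_pi.2 fun i => (contDiff_pi.1 T.contDiff_inv i.1).comp (contDiff_extendZero S)
  · obtain rfl : z' = φ z := M'.mix_injective (hz.trans (T.mix_eq z).symm)
    funext k
    exact hφdep _ _ (fun i hi => (extendZero_of_mem (fun i : A => z i) hi).symm) k.1 k.2

end LatentModel.IsTransition

namespace LatentModel

variable {U : Type w} {n d C : ℕ} (M : LatentModel U n d C)

lemma disjoint_parents_children : Disjoint M.parents M.children := by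
  rw [Finset.disjoint_left]
  intro i hp hc
  rw [mem_parents] at hp
  rw [mem_children] at hc
  exact M.acyclic none ((Relation.TransGen.single hc).tail hp)

lemma disjoint_parents_spouses : Disjoint M.parents M.spouses :=
  Finset.disjoint_right.2 fun _ h => (M.mem_spouses.1 h).1

lemma disjoint_children_spouses : Disjoint M.children M.spouses :=
  Finset.disjoint_right.2 fun _ h => (M.mem_spouses.1 h).2.1

end LatentModel

end LatentDA

end

theorem theorem2 {U : Type*} {n d C : ℕ} (M M' : LatentDA.LatentModel U n d C)
    (hZ : M.SufficientChangesZ) (hY : M.SufficientChangesY)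
    (hG : M.GroupSpecificIntimateNeighbors) (hF : M.Faithful)
    (hM' : M'.IsMinimalModelOf M) :
    ∃ S₁ S₂ S₃ : Finset (Fin n),
      (Disjoint S₁ S₂ ∧ Disjoint S₁ S₃ ∧ Disjoint S₂ S₃ ∧ S₁ ∪ S₂ ∪ S₃ = M'.blanket) ∧
      M.BlockInvertible M' M.parents S₁ ∧
      M.BlockInvertible M' M.children S₂ ∧
      M.BlockInvertible M' M.spouses S₃ := by
  obtain ⟨hobs, hF', hmin⟩ := hM'
  -- Sufficient changes provide a label value and a domain, so neither type is empty.
  obtain ⟨c, u, -⟩ := hZ 0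
  have : NeZero C := ⟨(Fin.pos c).ne'⟩
  have : Nonempty U := ⟨u 0⟩
  obtain ⟨φ, ψ, T⟩ := hobs.exists_isTransition
  have hcard : M'.edgeCount ≤ M.edgeCount := hmin M ⟨rfl, fun _ => rfl⟩ hF
  -- One base point is enough, since the row supports are constant.
  obtain ⟨σ, hσ⟩ := T.exists_perm 0
  have hblock : ∀ A : Finset (Fin n), (∀ i j, M.IntimateNeighbor i j → j ∈ A → i ∈ A) →
      M.BlockInvertible M' A (A.image σ) := by
    intro A hA
    refine T.blockInvertible (Finset.card_image_of_injective _ σ.injective).symm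
      fun y i hi k hk => ?_
    by_contra hne
    rw [← T.rowSupport_eq_image hF hZ hY hcard hσ hA, T.rowSupport_const hF hZ hY hcard hA 0 y] at hk
    exact hk (LatentDA.mem_rowSupport.2 ⟨i, hi, hne⟩)
  refine ⟨M.parents.image σ, M.children.image σ, M.spouses.image σ, ⟨?_, ?_, ?_, ?_⟩,
    hblock _ fun i j h => (hG i j h).1, hblock _ fun i j h => (hG i j h).2.1,
    hblock _ fun i j h => (hG i j h).2.2⟩
  · exact (Finset.disjoint_image σ.injective).2 M.disjoint_parents_children
  · exact (Finset.disjoint_image σ.injective).2 M.disjoint_parents_spouses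
  · exact (Finset.disjoint_image σ.injective).2 M.disjoint_children_spouses
  -- Both blankets are neighborhoods of the label, which the isomorphism fixes.
  · rw [← Finset.image_union, ← Finset.image_union]
    change M.blanket.image σ = M'.blanket
    ext k
    obtain ⟨i, rfl⟩ := σ.surjective k
    rw [σ.injective.mem_finset_image, ← M.adj_label_iff hF, ← M'.adj_label_iff hF']
    exact (T.adj_iff hF hZ hY hcard hσ (some i) none).symm
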